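/- **Setting.** Manifolds are smooth, Hausdorff, finite-dimensional and without boundary. A *Kenmotsu manifold* $(M,\varphi,\xi,\eta,g)$ is an odd-dimensional Riemannian manifold $(M,g)$ with Levi-Civita connection $\nabla$, a smooth $(1,1)$-tensor $\varphi$, a smooth vector field $\xi$ and a smooth 1-form $\eta$ with $$\varphi\xi=0,\quad \eta(\xi)=1,\quad \varphi^2=-I+\eta\otimes\xi,\quad g(\varphi E,\varphi F)=g(E,F)-\eta(E)\eta(F),$$ which is normal, $[\varphi,\varphi]+2d\eta\otimes\xi=0$, and satisfies $(\nabla_E\varphi)F=g(\varphi E,F)\xi-\eta(F)\varphi E$ for all vector fields $E,F$. A *Riemannian submersion* $\pi:(M,g)\to(N,g_N)$ is a smooth surjection with $\dim N<\dim M$ whose differential is onto at every point and preserves inner products of horizontal vectors, where $\ker\pi_*$ is the vertical and $(\ker\pi_*)^\perp$ the horizontal distribution, with orthogonal projections $\mathcal V$ and $\mathcal H$. It is *anti-invariant* if $\varphi(\ker\pi_*)\subseteq(\ker\pi_*)^\perp$. It is a *Clairaut submersion with $r$*, where $r:M\to(0,\infty)$, if for every geodesic $\alpha:I\to M$ ($I$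 an open interval) the function $(r\circ\alpha)\sin\theta$ is constant, $\theta(t)$ being the angle between $\dot\alpha(t)$ and the horizontal space at $\alpha(t)$. O'Neill's tensors are $$\mathcal T_EF=\mathcal V\nabla_{\mathcal VE}\mathcal HF+\mathcal H\nabla_{\mathcal VE}\mathcal VF,\qquad \mathcal A_EF=\mathcal V\nabla_{\mathcal HE}\mathcal HF+\mathcal H\nabla_{\mathcal HE}\mathcal VF,$$ and for horizontal $X$ one writes $\mathcal BX=\mathcal V\varphi X$, $\mathcal CX=\mathcal H\varphi X$. **Theorem.** Let $\pi$ be an anti-invariant Riemannian submersion from a Kenmotsu manifold $(M,\varphi,\xi,\eta,g)$ onto a Riemannian manifold $(N,g_N)$, such that the Reeb vector field $\xi$ is either everywhere vertical or everywhere horizontal. Let $f:M\to\mathbb R$ be smooth. Then $\pi$ is a Clairaut submersion with $r=e^f$ if and only if $\nabla f$ is horizontal and, for every geodesic $\alpha$ on $M$, $$\{g(\nabla f,X)-\eta(X)\}\,\|V\|^2=g\big(\mathcal H\nabla_{\dot\alpha}\mathcal CX+(\mathcal T_V+\mathcal A_X)\mathcal BX,\ \varphi V\big)$$ holds along $\alpha$,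 where $V(t)$ and $X(t)$ are the vertical and horizontal parts of $\dot\alpha(t)$. -/

import Mathlib

open Bundle Manifold
open scoped ContDiff

noncomputable section

namespace Clairaut

/-! ### Riemannian manifolds: Levi-Civita connection, gradient, geodesics

Throughout, `M` is a manifold without boundary modelled on a finite-dimensional real vector space
`E`, and its metric is Mathlib's `RiemannianBundle` structure on the tangent bundle; `inner ℝ v w`
is the metric `g(v, w)`. -/

section Riemannian

variable {E : Type*} [NormedAddCommGroup E] [NormedSpace ℝ E] [FiniteDimensional ℝ E]
  {M : Type*} [TopologicalSpace M] [ChartedSpace E M]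

instance tangentSpace_finiteDimensional (x : M) :
    FiniteDimensional ℝ (TangentSpace 𝓘(ℝ, E) x) :=
  inferInstanceAs (FiniteDimensional ℝ E)

/-- A vector field on `M` is smooth if it is smooth as a section of the tangent bundle. -/
def IsSmoothField [IsManifold 𝓘(ℝ, E) ∞ M] (X : ∀ x : M, TangentSpace 𝓘(ℝ, E) x) : Prop :=
  ContMDiff 𝓘(ℝ, E) (𝓘(ℝ, E).prod 𝓘(ℝ, E)) ∞
    (fun x ↦ TotalSpace.mk' E (E := (TangentSpace 𝓘(ℝ, E) : M → Type _)) x (X x))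

/-- The derivative `df(v)` of a real function `f` at `x` in the direction `v`. -/
def dirDeriv (f : M → ℝ) (x : M) (v : TangentSpace 𝓘(ℝ, E) x) : ℝ :=
  mvfderiv 𝓘(ℝ, E) f x v

variable [IsManifold 𝓘(ℝ, E) ∞ M] [RiemannianBundle (fun x : M ↦ TangentSpace 𝓘(ℝ, E) x)]

/-- The gradient of `f`: the vector with `g(∇f, v) = df(v)`, written in an orthonormal basis. -/
def grad (f : M → ℝ) (x : M) : TangentSpace 𝓘(ℝ, E) x :=
  ∑ i, dirDeriv f x (stdOrthonormalBasis ℝ (TangentSpace 𝓘(ℝ, E) x) i) •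
    stdOrthonormalBasis ℝ (TangentSpace 𝓘(ℝ, E) x) i

/-- The Koszul expression
`X g(Y,Z) + Y g(Z,X) - Z g(X,Y) + g([X,Y],Z) - g([Y,Z],X) + g([Z,X],Y)` at the point `x`. -/
def koszul (X Y Z : ∀ x : M, TangentSpace 𝓘(ℝ, E) x) (x : M) : ℝ :=
  dirDeriv (fun y ↦ inner ℝ (Y y) (Z y)) x (X x)
    + dirDeriv (fun y ↦ inner ℝ (Z y) (X y)) x (Y x)
    - dirDeriv (fun y ↦ inner ℝ (X y) (Y y)) x (Z x)
    + inner ℝ (VectorField.mlieBracket 𝓘(ℝ, E) X Y x) (Z x)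
    - inner ℝ (VectorField.mlieBracket 𝓘(ℝ, E) Y Z x) (X x)
    + inner ℝ (VectorField.mlieBracket 𝓘(ℝ, E) Z X x) (Y x)

/-- The Levi-Civita connection: `nabla Y x v` is the covariant derivative `∇_v Y` at `x`.
It is the vector with `2 g(∇_v Y, z) = koszul v Y z` (Koszul's formula), written in an orthonormal
basis. The Koszul expression depends on its first and third arguments through their values at `x`
only, so the vectors there are extended by the sections `FiberBundle.extend E v`, which have
constant coordinates in the trivialization of the tangent bundle at `x`. -/
def nabla (Y : ∀ x : M, TangentSpace 𝓘(ℝ, E) x) (x : M) (v : TangentSpace 𝓘(ℝ, E) x) :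
    TangentSpace 𝓘(ℝ, E) x :=
  ∑ i, (koszul (FiberBundle.extend E v) Y
      (FiberBundle.extend E (stdOrthonormalBasis ℝ (TangentSpace 𝓘(ℝ, E) x) i)) x / 2) •
    stdOrthonormalBasis ℝ (TangentSpace 𝓘(ℝ, E) x) i

/-- The velocity `α'(t)` of a curve. -/
def velocity (α : ℝ → M) (t : ℝ) : TangentSpace 𝓘(ℝ, E) (α t) :=
  (mfderiv 𝓘(ℝ, ℝ) 𝓘(ℝ, E) α t : ℝ →L[ℝ] TangentSpace 𝓘(ℝ, E) (α t)) 1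

/-- The covariant derivative `∇_{α'} W` of a vector field `W` along the curve `α`:
if `W = ∑ Wⁱ eᵢ` in the coordinate frame `eᵢ` of the tangent bundle at `α t`, this is
`∑ (Wⁱ)' eᵢ + ∑ Wⁱ ∇_{α'} eᵢ`. -/
def covDerivAlong (α : ℝ → M) (W : ∀ t, TangentSpace 𝓘(ℝ, E) (α t)) (t : ℝ) :
    TangentSpace 𝓘(ℝ, E) (α t) :=
  (trivializationAt E (TangentSpace 𝓘(ℝ, E) : M → Type _) (α t)).symm (α t)
      (deriv (fun s ↦ (trivializationAt E (TangentSpace 𝓘(ℝ, E) : M → Type _) (α t)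
        (TotalSpace.mk' E (α s) (W s))).2) t)
    + nabla (FiberBundle.extend E (W t)) (α t) (velocity α t)

/-- `α` is a geodesic on the open interval `s`. (A `C²` solution of `∇_{α'} α' = 0` is smooth.) -/
structure IsGeodesicOn (α : ℝ → M) (s : Set ℝ) : Prop where
  isOpen : IsOpen s
  ordConnected : s.OrdConnected
  contMDiffOn : ContMDiffOn 𝓘(ℝ, ℝ) 𝓘(ℝ, E) 2 α s
  covDeriv_velocity : ∀ t ∈ s, covDerivAlong (E := E) α (velocity α) t = 0

end Riemannian

/-! ### Almost contact metric and Kenmotsu manifolds -/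

section Contact

variable {E : Type*} [NormedAddCommGroup E] [NormedSpace ℝ E] [FiniteDimensional ℝ E]
  {M : Type*} [TopologicalSpace M] [ChartedSpace E M]
  [IsManifold 𝓘(ℝ, E) ∞ M] [RiemannianBundle (fun x : M ↦ TangentSpace 𝓘(ℝ, E) x)]

variable (E M) in
/-- An almost contact metric structure `(φ, ξ, η, g)` on the Riemannian manifold `M`. -/
structure AlmostContactMetric where
  /-- the `(1,1)`-tensor -/
  φ : ∀ x : M, TangentSpace 𝓘(ℝ, E) x →L[ℝ] TangentSpace 𝓘(ℝ, E) x
  /-- the Reeb vector field -/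
  ξ : ∀ x : M, TangentSpace 𝓘(ℝ, E) x
  /-- the dual `1`-form -/
  η : ∀ x : M, TangentSpace 𝓘(ℝ, E) x →L[ℝ] ℝ
  odd_dim : ∃ m : ℕ, Module.finrank ℝ E = 2 * m + 1
  φ_smooth : ContMDiff 𝓘(ℝ, E) (𝓘(ℝ, E).prod 𝓘(ℝ, E →L[ℝ] E)) ∞
    (fun x ↦ TotalSpace.mk' (E →L[ℝ] E)
      (E := fun x : M ↦ TangentSpace 𝓘(ℝ, E) x →L[ℝ] TangentSpace 𝓘(ℝ, E) x) x (φ x))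
  ξ_smooth : IsSmoothField ξ
  η_smooth : ContMDiff 𝓘(ℝ, E) (𝓘(ℝ, E).prod 𝓘(ℝ, E →L[ℝ] ℝ)) ∞
    (fun x ↦ TotalSpace.mk' (E →L[ℝ] ℝ)
      (E := fun x : M ↦ TangentSpace 𝓘(ℝ, E) x →L[ℝ] Bundle.Trivial M ℝ x) x (η x))
  φ_ξ : ∀ x, φ x (ξ x) = 0
  η_ξ : ∀ x, η x (ξ x) = 1
  φ_φ : ∀ x v, φ x (φ x v) = -v + η x v • ξ x
  inner_φ_φ : ∀ x (v w : TangentSpace 𝓘(ℝ, E) x),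
    (inner ℝ (φ x v) (φ x w) : ℝ) = inner ℝ v w - η x v * η x w

namespace AlmostContactMetric

variable (S : AlmostContactMetric E M)

/-- `2 dη(X, Y) = X (η Y) - Y (η X) - η [X, Y]`. -/
def twoDη (X Y : ∀ x : M, TangentSpace 𝓘(ℝ, E) x) (x : M) : ℝ :=
  dirDeriv (fun y ↦ S.η y (Y y)) x (X x) - dirDeriv (fun y ↦ S.η y (X y)) x (Y x)
    - S.η x (VectorField.mlieBracket 𝓘(ℝ, E) X Y x)

/-- The Nijenhuis tensor `[φ, φ]`. -/
def nijenhuis (X Y : ∀ x : M, TangentSpace 𝓘(ℝ, E) x) (x : M) : TangentSpace 𝓘(ℝ, E) x :=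
  S.φ x (S.φ x (VectorField.mlieBracket 𝓘(ℝ, E) X Y x))
    + VectorField.mlieBracket 𝓘(ℝ, E) (fun y ↦ S.φ y (X y)) (fun y ↦ S.φ y (Y y)) x
    - S.φ x (VectorField.mlieBracket 𝓘(ℝ, E) (fun y ↦ S.φ y (X y)) Y x)
    - S.φ x (VectorField.mlieBracket 𝓘(ℝ, E) X (fun y ↦ S.φ y (Y y)) x)

/-- Normality: `[φ, φ] + 2 dη ⊗ ξ = 0`. -/
def IsNormal : Prop :=
  ∀ X Y : (∀ x : M, TangentSpace 𝓘(ℝ, E) x), IsSmoothField X → IsSmoothField Y →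
    ∀ x, S.nijenhuis X Y x + S.twoDη X Y x • S.ξ x = 0

/-- A Kenmotsu structure: normal, and `(∇_v φ) Y = g(φ v, Y) ξ - η(Y) φ v`, where
`(∇_v φ) Y = ∇_v (φ Y) - φ (∇_v Y)`. -/
structure IsKenmotsu : Prop where
  normal : S.IsNormal
  nabla_φ : ∀ Y : (∀ x : M, TangentSpace 𝓘(ℝ, E) x), IsSmoothField Y →
    ∀ (x : M) (v : TangentSpace 𝓘(ℝ, E) x),
      nabla (fun y ↦ S.φ y (Y y)) x v - S.φ x (nabla Y x v)
        = (inner ℝ (S.φ x v) (Y x) : ℝ) • S.ξ x - S.η x (Y x) • S.φ x v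

end AlmostContactMetric

end Contact

/-! ### Riemannian submersions -/

section Submersion

variable {E : Type*} [NormedAddCommGroup E] [NormedSpace ℝ E] [FiniteDimensional ℝ E]
  {M : Type*} [TopologicalSpace M] [ChartedSpace E M]
  [IsManifold 𝓘(ℝ, E) ∞ M] [RiemannianBundle (fun x : M ↦ TangentSpace 𝓘(ℝ, E) x)]
  {F : Type*} [NormedAddCommGroup F] [NormedSpace ℝ F] [FiniteDimensional ℝ F]
  {N : Type*} [TopologicalSpace N] [ChartedSpace F N]
  [IsManifold 𝓘(ℝ, F) ∞ N]

variable (E F) in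
/-- The vertical space `ker pr_*` at `x`. -/
def vertical (pr : M → N) (x : M) : Submodule ℝ (TangentSpace 𝓘(ℝ, E) x) :=
  LinearMap.ker (mfderiv 𝓘(ℝ, E) 𝓘(ℝ, F) pr x).toLinearMap

variable (E F) in
/-- The horizontal space `(ker pr_*)ᗮ` at `x`. -/
def horizontal (pr : M → N) (x : M) : Submodule ℝ (TangentSpace 𝓘(ℝ, E) x) :=
  (vertical E F pr x)ᗮ

variable (F) in
/-- The vertical part of a tangent vector (orthogonal projection onto `ker pr_*`). -/
def vPart (pr : M → N) (x : M) (v : TangentSpace 𝓘(ℝ, E) x) : TangentSpace 𝓘(ℝ, E) x :=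
  (vertical E F pr x).starProjection v

variable (F) in
/-- The horizontal part of a tangent vector (orthogonal projection onto `(ker pr_*)ᗮ`). -/
def hPart (pr : M → N) (x : M) (v : TangentSpace 𝓘(ℝ, E) x) : TangentSpace 𝓘(ℝ, E) x :=
  (horizontal E F pr x).starProjection v

variable (E F) in
/-- `pr` is a Riemannian submersion: a smooth surjection onto a manifold of smaller dimension whose
differential is onto and preserves inner products of horizontal vectors. -/
structure IsRiemannianSubmersion [RiemannianBundle (fun y : N ↦ TangentSpace 𝓘(ℝ, F) y)]
    (pr : M → N) : Prop where
  dim_lt : Module.finrank ℝ F < Module.finrank ℝ E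
  contMDiff : ContMDiff 𝓘(ℝ, E) 𝓘(ℝ, F) ∞ pr
  surjective : Function.Surjective pr
  surjective_mfderiv : ∀ x, Function.Surjective (mfderiv 𝓘(ℝ, E) 𝓘(ℝ, F) pr x)
  inner_mfderiv : ∀ x, ∀ v ∈ horizontal E F pr x, ∀ w ∈ horizontal E F pr x,
    (inner ℝ (mfderiv 𝓘(ℝ, E) 𝓘(ℝ, F) pr x v) (mfderiv 𝓘(ℝ, E) 𝓘(ℝ, F) pr x w) : ℝ) = inner ℝ v w

variable (F) in
/-- O'Neill's tensor `T_v w = 𝒱 ∇_{𝒱v} ℋW + ℋ ∇_{𝒱v} 𝒱W`, where the field `W` extends `w`. -/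
def oneillT (pr : M → N) (x : M) (v w : TangentSpace 𝓘(ℝ, E) x) : TangentSpace 𝓘(ℝ, E) x :=
  vPart F pr x (nabla (fun y ↦ hPart F pr y (FiberBundle.extend E w y)) x (vPart F pr x v))
    + hPart F pr x (nabla (fun y ↦ vPart F pr y (FiberBundle.extend E w y)) x (vPart F pr x v))

variable (F) in
/-- O'Neill's tensor `A_v w = 𝒱 ∇_{ℋv} ℋW + ℋ ∇_{ℋv} 𝒱W`, where the field `W` extends `w`. -/
def oneillA (pr : M → N) (x : M) (v w : TangentSpace 𝓘(ℝ, E) x) : TangentSpace 𝓘(ℝ, E) x :=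
  vPart F pr x (nabla (fun y ↦ hPart F pr y (FiberBundle.extend E w y)) x (hPart F pr x v))
    + hPart F pr x (nabla (fun y ↦ vPart F pr y (FiberBundle.extend E w y)) x (hPart F pr x v))

variable (E F) in
/-- `pr` is a Clairaut submersion with the positive function `r`: along every geodesic, the function
`r sin θ` is constant, where `θ` is the angle between the velocity and the horizontal space, that
is, between the velocity and its horizontal part (`θ = 90°` if the latter vanishes). -/
structure IsClairautWith [RiemannianBundle (fun y : N ↦ TangentSpace 𝓘(ℝ, F) y)]
    (pr : M → N) (r : M → ℝ) : Prop where
  isRiemannianSubmersion : IsRiemannianSubmersion E F pr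
  pos : ∀ x, 0 < r x
  constant : ∀ (α : ℝ → M) (s : Set ℝ), IsGeodesicOn (E := E) α s → ∀ t₁ ∈ s, ∀ t₂ ∈ s,
    r (α t₁) * Real.sin (InnerProductGeometry.angle
        (velocity (E := E) α t₁) (hPart F pr (α t₁) (velocity α t₁)))
      = r (α t₂) * Real.sin (InnerProductGeometry.angle
        (velocity (E := E) α t₂) (hPart F pr (α t₂) (velocity α t₂)))

namespace AlmostContactMetric

variable (S : AlmostContactMetric E M)

variable (F) in
/-- An anti-invariant Riemannian submersion: `φ (ker pr_*) ⊆ (ker pr_*)ᗮ`. -/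
structure IsAntiInvariant [RiemannianBundle (fun y : N ↦ TangentSpace 𝓘(ℝ, F) y)]
    (pr : M → N) : Prop where
  isRiemannianSubmersion : IsRiemannianSubmersion E F pr
  φ_mem : ∀ x, ∀ v ∈ vertical E F pr x, S.φ x v ∈ horizontal E F pr x

variable (F) in
/-- The Reeb vector field is tangent to the fibres. -/
def ReebVertical (pr : M → N) : Prop := ∀ x, S.ξ x ∈ vertical E F pr x

variable (F) in
/-- The Reeb vector field is normal to the fibres. -/
def ReebHorizontal (pr : M → N) : Prop := ∀ x, S.ξ x ∈ horizontal E F pr x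

variable (F) in
/-- `ℬ v = 𝒱 (φ v)`, for horizontal `v`. -/
def B (pr : M → N) (x : M) (v : TangentSpace 𝓘(ℝ, E) x) : TangentSpace 𝓘(ℝ, E) x :=
  vPart F pr x (S.φ x v)

variable (F) in
/-- `𝒞 v = ℋ (φ v)`, for horizontal `v`. -/
def C (pr : M → N) (x : M) (v : TangentSpace 𝓘(ℝ, E) x) : TangentSpace 𝓘(ℝ, E) x :=
  hPart F pr x (S.φ x v)

end AlmostContactMetric

end Submersion

end Clairaut

end

/-!
# Clairaut anti-invariant submersions from Kenmotsu manifolds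

Let `α` be a geodesic with velocity `α' = V + X`, `V` vertical and `X` horizontal. Its speed is
constant and `‖α'‖ sin θ = ‖V‖`, so the Clairaut condition with `r = e^f` says that `e^f ‖V‖` is
constant along `α`. Differentiating the square, this is the identity
`g(∇f, α') ‖V‖² + g(∇_{α'} V, V) = 0` along all geodesics (`isClairautWith_exp_iff`).

The identity forces `∇f` to be horizontal (`grad_mem_horizontal`): on the geodesic with a vertical
initial velocity `w`, the function `‖V‖²` is bounded by the constant `‖α'‖² = ‖w‖²` and attains this
bound initially, so its derivative `2 g(∇_{α'} V, V)` vanishes there and `g(∇f, w) ‖w‖² = 0`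
remains.

If `ξ` is horizontal, then `η(V) = 0`. By the Kenmotsu identity, `∇_{α'} (φ α') = -η(X) φ α'`
(`IsGeodesicOn.covDerivAlong_φ_velocity`). Decompose `φ α' = φ V + ℬ X + 𝒞 X` and take the inner
product with the horizontal vector `φ V`: as `φ` is isometric on vertical vectors, `∇_{α'} (φ V)`
contributes `g(∇_{α'} V, V)`, and the horizontal part of `∇_{α'} (ℬ X)` is `(T_V + A_X) ℬ X`. Hence
the right-hand side of the Clairaut formula equals `-g(∇_{α'} V, V) - η(X) ‖V‖²`
(`IsGeodesicOn.inner_covDerivAlong_C`), and for horizontal `∇f` the formula is the differential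
identity above.

If `ξ` is vertical, there are no horizontal vectors besides `0`
(`AlmostContactMetric.ReebVertical.eq_zero_of_mem_horizontal`): for horizontal `v`, the Kenmotsu
identity gives `g(∇_v ξ, v) = ‖v‖²`, whereas `g(∇_v ξ, v) = 0` because the metric on horizontal
vectors is pulled back from the base and so does not change along the fibres. Then `X = 0` and
`φ V = 0`, the formula reads `0 = 0`, and both conditions of the theorem say that `∇f = 0`.

Covariant derivatives are computed in charts. `coordL` and `frameL` pass between tangent vectors and
coordinates, `fieldRep`, `alongRep`, `endRep` and `metricRep` are the coordinate expressions of
fields, fields along curves, endomorphism fields and the metric, and `coordL_nabla` and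
`coordL_covDerivAlong` express the connection by Christoffel symbols. These give the metric property
of the connection (`hasDerivAt_inner_along`), the Leibniz rule for endomorphism fields
(`covDerivAlong_end`), and, with the Picard–Lindelöf theorem, the existence of geodesics
(`exists_geodesic`).
-/

-- The variables of each section are the standing assumptions of its topic.
set_option linter.unusedSectionVars false

noncomputable section

namespace Clairaut

open Set Filter Topology

/-! ### Coordinates on the tangent bundle -/

section Chart

variable {E : Type*} [NormedAddCommGroup E] [NormedSpace ℝ E]
  {M : Type*} [TopologicalSpace M] [ChartedSpace E M] [IsManifold 𝓘(ℝ, E) ∞ M]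

/-- Coordinates of tangent vectors at `y` in the chart at `x₀`; the zero map if `y` is outside the
domain of the chart. -/
def coordL (x₀ y : M) : TangentSpace 𝓘(ℝ, E) y →L[ℝ] E :=
  (trivializationAt E (TangentSpace 𝓘(ℝ, E) : M → Type _) x₀).continuousLinearMapAt ℝ y

/-- The tangent vector at `y` with given coordinates in the chart at `x₀`; zero if `y` is outside
the domain of the chart. -/
def frameL (x₀ y : M) : E →L[ℝ] TangentSpace 𝓘(ℝ, E) y :=
  (trivializationAt E (TangentSpace 𝓘(ℝ, E) : M → Type _) x₀).symmL ℝ y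

lemma mem_baseSet_of_mem_source {x₀ y : M} (hy : y ∈ (extChartAt 𝓘(ℝ, E) x₀).source) :
    y ∈ (trivializationAt E (TangentSpace 𝓘(ℝ, E) : M → Type _) x₀).baseSet := by
  rw [extChartAt_source] at hy
  rwa [TangentBundle.trivializationAt_baseSet]

lemma frameL_apply {x₀ y : M} (hy : y ∈ (extChartAt 𝓘(ℝ, E) x₀).source) (a : E) :
    frameL x₀ y a = (trivializationAt E (TangentSpace 𝓘(ℝ, E) : M → Type _) x₀).symm y a :=
  Trivialization.symmL_apply _ (mem_baseSet_of_mem_source hy) a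

lemma frameL_coordL {x₀ y : M} (hy : y ∈ (extChartAt 𝓘(ℝ, E) x₀).source)
    (v : TangentSpace 𝓘(ℝ, E) y) : frameL x₀ y (coordL x₀ y v) = v :=
  Trivialization.symmL_continuousLinearMapAt _ (mem_baseSet_of_mem_source hy) v

lemma coordL_frameL {x₀ y : M} (hy : y ∈ (extChartAt 𝓘(ℝ, E) x₀).source) (a : E) :
    coordL x₀ y (frameL x₀ y a) = a :=
  Trivialization.continuousLinearMapAt_symmL _ (mem_baseSet_of_mem_source hy) a

lemma coordL_injective {x₀ y : M} (hy : y ∈ (extChartAt 𝓘(ℝ, E) x₀).source) :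
    Function.Injective (coordL (E := E) x₀ y) :=
  Function.LeftInverse.injective (frameL_coordL hy)

lemma coordL_eq_snd {x₀ y : M} (hy : y ∈ (extChartAt 𝓘(ℝ, E) x₀).source)
    (v : TangentSpace 𝓘(ℝ, E) y) : coordL x₀ y v =
      (trivializationAt E (TangentSpace 𝓘(ℝ, E) : M → Type _) x₀ (TotalSpace.mk' E y v)).2 := by
  rw [coordL, Trivialization.continuousLinearMapAt_apply,
    Trivialization.coe_linearMapAt_of_mem _ (mem_baseSet_of_mem_source hy)]

lemma coordL_eq_mfderiv {x₀ y : M} (hy : y ∈ (extChartAt 𝓘(ℝ, E) x₀).source) :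
    coordL x₀ y = mfderiv 𝓘(ℝ, E) 𝓘(ℝ, E) (extChartAt 𝓘(ℝ, E) x₀) y := by
  rw [extChartAt_source] at hy
  exact TangentBundle.continuousLinearMapAt_trivializationAt hy

lemma frameL_eq_mfderiv {x₀ : M} {u : E} (hu : u ∈ (extChartAt 𝓘(ℝ, E) x₀).target) :
    frameL (E := E) x₀ ((extChartAt 𝓘(ℝ, E) x₀).symm u) =
      mfderiv 𝓘(ℝ, E) 𝓘(ℝ, E) (extChartAt 𝓘(ℝ, E) x₀).symm u := by
  have hy := (extChartAt 𝓘(ℝ, E) x₀).map_target hu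
  rw [extChartAt_source] at hy
  have := TangentBundle.symmL_trivializationAt (I := 𝓘(ℝ, E)) hy
  rwa [modelWithCornersSelf_coe, range_id, mfderivWithin_univ,
    (extChartAt 𝓘(ℝ, E) x₀).right_inv hu] at this

/-- The coordinate expression, in the chart at `x₀`, of a vector field. -/
def fieldRep (x₀ : M) (Y : ∀ x : M, TangentSpace 𝓘(ℝ, E) x) (u : E) : E :=
  coordL x₀ ((extChartAt 𝓘(ℝ, E) x₀).symm u) (Y ((extChartAt 𝓘(ℝ, E) x₀).symm u))

lemma fieldRep_apply {x₀ y : M} (hy : y ∈ (extChartAt 𝓘(ℝ, E) x₀).source)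
    (Y : ∀ x : M, TangentSpace 𝓘(ℝ, E) x) :
    fieldRep x₀ Y (extChartAt 𝓘(ℝ, E) x₀ y) = coordL x₀ y (Y y) := by
  rw [fieldRep, (extChartAt 𝓘(ℝ, E) x₀).left_inv hy]

lemma target_mem_nhds {x₀ y : M} (hy : y ∈ (extChartAt 𝓘(ℝ, E) x₀).source) :
    (extChartAt 𝓘(ℝ, E) x₀).target ∈ 𝓝 (extChartAt 𝓘(ℝ, E) x₀ y) :=
  (isOpen_extChartAt_target x₀).mem_nhds ((extChartAt 𝓘(ℝ, E) x₀).map_source hy)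

lemma contMDiffAt_symm {x₀ y : M} (hy : y ∈ (extChartAt 𝓘(ℝ, E) x₀).source) :
    ContMDiffAt 𝓘(ℝ, E) 𝓘(ℝ, E) ∞ (extChartAt 𝓘(ℝ, E) x₀).symm (extChartAt 𝓘(ℝ, E) x₀ y) :=
  (contMDiffOn_extChartAt_symm x₀).contMDiffAt (target_mem_nhds hy)

lemma contMDiffAt_chart {x₀ y : M} (hy : y ∈ (extChartAt 𝓘(ℝ, E) x₀).source) :
    ContMDiffAt 𝓘(ℝ, E) 𝓘(ℝ, E) ∞ (extChartAt 𝓘(ℝ, E) x₀) y := by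
  rw [extChartAt_source] at hy
  exact contMDiffAt_extChartAt' hy

/-- A map on `M` is differentiable at `y` iff its expression in the chart is. -/
lemma mdifferentiableAt_iff_comp_symm {G : Type*} [NormedAddCommGroup G] [NormedSpace ℝ G]
    {x₀ y : M} (hy : y ∈ (extChartAt 𝓘(ℝ, E) x₀).source) (f : M → G) :
    MDifferentiableAt 𝓘(ℝ, E) 𝓘(ℝ, G) f y ↔
      DifferentiableAt ℝ (f ∘ (extChartAt 𝓘(ℝ, E) x₀).symm) (extChartAt 𝓘(ℝ, E) x₀ y) := by
  rw [← mdifferentiableAt_iff_differentiableAt]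
  constructor
  · intro h
    refine MDifferentiableAt.comp _ (I' := 𝓘(ℝ, E)) ?_
      ((contMDiffAt_symm hy).mdifferentiableAt (by simp))
    rwa [(extChartAt 𝓘(ℝ, E) x₀).left_inv hy]
  · intro h
    have h2 := MDifferentiableAt.comp y h ((contMDiffAt_chart hy).mdifferentiableAt (by simp))
    refine h2.congr_of_eventuallyEq ?_
    filter_upwards [(isOpen_extChartAt_source x₀).mem_nhds hy] with z hz
    exact (congrArg f ((extChartAt 𝓘(ℝ, E) x₀).left_inv hz)).symm

lemma mdifferentiableAt_field_iff {x₀ y : M} (hy : y ∈ (extChartAt 𝓘(ℝ, E) x₀).source)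
    (Y : ∀ x : M, TangentSpace 𝓘(ℝ, E) x) :
    MDifferentiableAt 𝓘(ℝ, E) (𝓘(ℝ, E).prod 𝓘(ℝ, E))
      (fun x ↦ TotalSpace.mk' E (E := (TangentSpace 𝓘(ℝ, E) : M → Type _)) x (Y x)) y ↔
    DifferentiableAt ℝ (fieldRep x₀ Y) (extChartAt 𝓘(ℝ, E) x₀ y) := by
  rw [Trivialization.mdifferentiableAt_section_iff _
    (trivializationAt E (TangentSpace 𝓘(ℝ, E) : M → Type _) x₀) Y (mem_baseSet_of_mem_source hy),
    mdifferentiableAt_iff_comp_symm hy]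
  refine Filter.EventuallyEq.differentiableAt_iff ?_
  filter_upwards [target_mem_nhds hy] with u hu
  exact (coordL_eq_snd ((extChartAt 𝓘(ℝ, E) x₀).map_target hu) _).symm

lemma contMDiffOn_frameL (x₀ : M) (a : E) :
    ContMDiffOn 𝓘(ℝ, E) (𝓘(ℝ, E).prod 𝓘(ℝ, E)) ∞
      (fun y ↦ TotalSpace.mk' E (E := (TangentSpace 𝓘(ℝ, E) : M → Type _)) y (frameL x₀ y a))
      (extChartAt 𝓘(ℝ, E) x₀).source := by
  intro y hy
  have hb := mem_baseSet_of_mem_source hy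
  have := (Trivialization.contMDiffWithinAt_section (IB := 𝓘(ℝ, E)) (n := ∞)
    (e := trivializationAt E (TangentSpace 𝓘(ℝ, E) : M → Type _) x₀)
    (s := fun y ↦ frameL x₀ y a) (a := (extChartAt 𝓘(ℝ, E) x₀).source) hb)
  refine this.2 ?_
  refine (contMDiffWithinAt_const (c := a)).congr_of_mem (fun z hz ↦ ?_) hy
  exact (coordL_eq_snd hz _).symm.trans (coordL_frameL hz a)

lemma dirDeriv_eq {x₀ y : M} (hy : y ∈ (extChartAt 𝓘(ℝ, E) x₀).source) {f : M → ℝ}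
    (hf : DifferentiableAt ℝ (f ∘ (extChartAt 𝓘(ℝ, E) x₀).symm) (extChartAt 𝓘(ℝ, E) x₀ y))
    (v : TangentSpace 𝓘(ℝ, E) y) :
    dirDeriv f y v = fderiv ℝ (f ∘ (extChartAt 𝓘(ℝ, E) x₀).symm) (extChartAt 𝓘(ℝ, E) x₀ y)
      (coordL x₀ y v) := by
  have h1 : mfderiv 𝓘(ℝ, E) 𝓘(ℝ, ℝ) f y = mfderiv 𝓘(ℝ, E) 𝓘(ℝ, ℝ)
      ((f ∘ (extChartAt 𝓘(ℝ, E) x₀).symm) ∘ extChartAt 𝓘(ℝ, E) x₀) y := by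
    refine Filter.EventuallyEq.mfderiv_eq ?_
    filter_upwards [(isOpen_extChartAt_source x₀).mem_nhds hy] with z hz
    exact (congrArg f ((extChartAt 𝓘(ℝ, E) x₀).left_inv hz)).symm
  rw [mfderiv_comp y hf.mdifferentiableAt ((contMDiffAt_chart hy).mdifferentiableAt (by simp)),
    ← coordL_eq_mfderiv hy, mfderiv_eq_fderiv] at h1
  have h2 := congrArg (fun L ↦ L v) h1
  exact h2

lemma isInvertible_mfderiv_symm {x₀ : M} {u : E} (hu : u ∈ (extChartAt 𝓘(ℝ, E) x₀).target) :
    (mfderiv 𝓘(ℝ, E) 𝓘(ℝ, E) (extChartAt 𝓘(ℝ, E) x₀).symm u).IsInvertible := by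
  have := isInvertible_mfderivWithin_extChartAt_symm (I := 𝓘(ℝ, E)) hu
  rwa [modelWithCornersSelf_coe, range_id, mfderivWithin_univ] at this

lemma mpullback_symm_eq {x₀ : M} {u : E} (hu : u ∈ (extChartAt 𝓘(ℝ, E) x₀).target)
    (Y : ∀ x : M, TangentSpace 𝓘(ℝ, E) x) :
    VectorField.mpullback 𝓘(ℝ, E) 𝓘(ℝ, E) (extChartAt 𝓘(ℝ, E) x₀).symm Y u = fieldRep x₀ Y u := by
  rw [VectorField.mpullback_apply]
  have hy := (extChartAt 𝓘(ℝ, E) x₀).map_target hu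
  have h1 := frameL_eq_mfderiv hu
  have h2 : mfderiv 𝓘(ℝ, E) 𝓘(ℝ, E) (extChartAt 𝓘(ℝ, E) x₀).symm u
      (fieldRep (E := E) x₀ Y u : E)
      = Y ((extChartAt 𝓘(ℝ, E) x₀).symm u) := by
    rw [← h1]
    exact frameL_coordL hy _
  rw [← h2]
  exact (isInvertible_mfderiv_symm hu).inverse_apply_self _

/-- The Lie bracket in coordinates. -/
lemma coordL_mlieBracket [CompleteSpace E] {x₀ y : M} (hy : y ∈ (extChartAt 𝓘(ℝ, E) x₀).source)
    {X Y : ∀ x : M, TangentSpace 𝓘(ℝ, E) x}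
    (hX : DifferentiableAt ℝ (fieldRep x₀ X) (extChartAt 𝓘(ℝ, E) x₀ y))
    (hY : DifferentiableAt ℝ (fieldRep x₀ Y) (extChartAt 𝓘(ℝ, E) x₀ y)) :
    coordL x₀ y (VectorField.mlieBracket 𝓘(ℝ, E) X Y y) =
      fderiv ℝ (fieldRep x₀ Y) (extChartAt 𝓘(ℝ, E) x₀ y) (coordL x₀ y (X y))
      - fderiv ℝ (fieldRep x₀ X) (extChartAt 𝓘(ℝ, E) x₀ y) (coordL x₀ y (Y y)) := by
  have hu := (extChartAt 𝓘(ℝ, E) x₀).map_source hy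
  rw [← mdifferentiableAt_field_iff hy] at hX hY
  have hyy := (extChartAt 𝓘(ℝ, E) x₀).left_inv hy
  have : IsManifold 𝓘(ℝ, E) (minSmoothness ℝ 2) M := by
    rw [minSmoothness_of_isRCLikeNormedField]; infer_instance
  have h := VectorField.mpullback_mlieBracket (I := 𝓘(ℝ, E)) (I' := 𝓘(ℝ, E)) (V := X) (W := Y)
    (f := (extChartAt 𝓘(ℝ, E) x₀).symm) (x₀ := extChartAt 𝓘(ℝ, E) x₀ y) (n := ∞)
    (by rwa [hyy]) (by rwa [hyy]) (contMDiffAt_symm hy) (by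
      rw [minSmoothness_of_isRCLikeNormedField]; exact WithTop.coe_le_coe.2 le_top)
  rw [mpullback_symm_eq hu, fieldRep_apply hy] at h
  rw [h]
  have e (Z : ∀ x : M, TangentSpace 𝓘(ℝ, E) x) :
      VectorField.mpullback 𝓘(ℝ, E) 𝓘(ℝ, E) (extChartAt 𝓘(ℝ, E) x₀).symm Z
        =ᶠ[𝓝 (extChartAt 𝓘(ℝ, E) x₀ y)] fieldRep x₀ Z := by
    filter_upwards [target_mem_nhds hy] with u hu using mpullback_symm_eq hu Z
  have hb (A B : ∀ u : E, TangentSpace 𝓘(ℝ, E) u) (u : E) :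
      VectorField.mlieBracket 𝓘(ℝ, E) A B u = VectorField.lieBracket ℝ A B u := by
    rw [← VectorField.mlieBracketWithin_univ, VectorField.mlieBracketWithin_eq_lieBracketWithin]
    exact congrFun VectorField.lieBracketWithin_univ u
  refine ((e X).mlieBracket_vectorField_eq (e Y)).trans ((hb _ _ _).trans ?_)
  rw [VectorField.lieBracket, fieldRep_apply hy, fieldRep_apply hy]

end Chart

/-! ### Metrics and Christoffel symbols on a vector space -/

section CoordMetric

variable {E : Type*} [NormedAddCommGroup E] [NormedSpace ℝ E] [FiniteDimensional ℝ E]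

/-- A shortcut: with the namespace `Bundle` open, the search for this instance on a twofold space of
continuous linear maps is slow. -/
instance instNormedAddCommGroupBilin : NormedAddCommGroup (E →L[ℝ] E →L[ℝ] ℝ) :=
  ContinuousLinearMap.toNormedAddCommGroup

/-- The companion of `instNormedAddCommGroupBilin` for the vector space structure. -/
instance instNormedSpaceBilin : NormedSpace ℝ (E →L[ℝ] E →L[ℝ] ℝ) :=
  ContinuousLinearMap.toNormedSpace

/-- A nondegenerate bilinear form on a finite-dimensional space is invertible as a map to the
dual. -/
lemma isInvertible_of_nondegenerate {B : E →L[ℝ] E →L[ℝ] ℝ}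
    (h : ∀ a, (∀ c, B a c = 0) → a = 0) : B.IsInvertible := by
  have hinj : Function.Injective B.toLinearMap := by
    rw [injective_iff_map_eq_zero]
    exact fun a ha ↦ h a fun c ↦ congrArg (fun L : E →L[ℝ] ℝ ↦ L c) ha
  have hfr : Module.finrank ℝ E = Module.finrank ℝ (E →L[ℝ] ℝ) := by
    rw [← (LinearMap.toContinuousLinearMap (𝕜 := ℝ) (E := E) (F' := ℝ)).finrank_eq]
    exact (Subspace.dual_finrank_eq (K := ℝ) (V := E)).symm
  exact ⟨(LinearEquiv.ofInjectiveOfFinrankEq _ hinj hfr).toContinuousLinearEquiv,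
    by ext; rfl⟩

lemma fderiv_apply_apply {G : E → E →L[ℝ] E →L[ℝ] ℝ} {u : E} (hG : DifferentiableAt ℝ G u)
    (a b c : E) : fderiv ℝ (fun w ↦ G w b c) u a = fderiv ℝ G u a b c := by
  have h := (hG.hasFDerivAt.clm_apply (hasFDerivAt_const b u)).clm_apply (hasFDerivAt_const c u)
  rw [h.fderiv]
  simp

lemma fderiv_comm_of_symm {G : E → E →L[ℝ] E →L[ℝ] ℝ} {u : E} (hG : DifferentiableAt ℝ G u)
    (hs : ∀ u a b, G u a b = G u b a) (a b c : E) : fderiv ℝ G u a b c = fderiv ℝ G u a c b := by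
  rw [← fderiv_apply_apply hG, ← fderiv_apply_apply hG]
  simp_rw [hs _ c b]

/-- The Christoffel symbols, as an `E`-valued bilinear map, of a metric `G` on an open subset
of `E`: the vector representing half of `∂_a G(b, ·) + ∂_b G(·, a) - ∂_· G(a, b)`. -/
def christoffel (G : E → E →L[ℝ] E →L[ℝ] ℝ) (u a b : E) : E :=
  (G u).inverse ((2⁻¹ : ℝ) • (fderiv ℝ G u a b + (fderiv ℝ G u b).flip a
      - ((fderiv ℝ G u).flip a).flip b))

lemma apply_christoffel {G : E → E →L[ℝ] E →L[ℝ] ℝ} {u : E} (hG : (G u).IsInvertible)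
    (a b c : E) : G u (christoffel G u a b) c =
      2⁻¹ * (fderiv ℝ G u a b c + fderiv ℝ G u b c a - fderiv ℝ G u c a b) := by
  rw [christoffel, hG.self_apply_inverse]
  simp only [smul_apply, sub_apply, add_apply,
    ContinuousLinearMap.flip_apply, smul_eq_mul]

set_option synthInstance.maxHeartbeats 100000 in
lemma contDiffAt_christoffel {G : E → E →L[ℝ] E →L[ℝ] ℝ} {p : E × E}
    (hi : (G p.1).IsInvertible) (hG : ContDiffAt ℝ 2 G p.1) :
    ContDiffAt ℝ 1 (fun p : E × E ↦ christoffel G p.1 p.2 p.2) p := by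
  have h0 : ContDiffAt ℝ 1 (fun p : E × E ↦ G p.1) p :=
    (hG.of_le one_le_two).comp p contDiffAt_fst
  have h1 : ContDiffAt ℝ 1 (fun p : E × E ↦ fderiv ℝ G p.1) p :=
    (hG.fderiv_right (m := 1) (by norm_num)).comp p contDiffAt_fst
  have hflip : ContDiff ℝ 1 (fun L : E →L[ℝ] E →L[ℝ] ℝ ↦ L.flip) :=
    (ContinuousLinearMap.flipₗᵢ ℝ E E ℝ).contDiff
  have hflip' : ContDiff ℝ 1 (fun L : E →L[ℝ] E →L[ℝ] E →L[ℝ] ℝ ↦ L.flip) :=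
    (ContinuousLinearMap.flipₗᵢ ℝ E E (E →L[ℝ] ℝ)).contDiff
  have hinv : ContDiffAt ℝ 1 (fun p : E × E ↦ (G p.1).inverse) p := by
    obtain ⟨e, he⟩ := hi
    have h := contDiffAt_map_inverse (𝕜 := ℝ) (n := 1) e
    rw [he] at h
    exact h.comp p h0
  have h2 : ContDiffAt ℝ 1 (fun p : E × E ↦ fderiv ℝ G p.1 p.2) p :=
    h1.clm_apply contDiffAt_snd
  have h3 : ContDiffAt ℝ 1 (fun p : E × E ↦ (fderiv ℝ G p.1 p.2).flip p.2) p :=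
    (hflip.contDiffAt.comp p h2).clm_apply contDiffAt_snd
  have h4 : ContDiffAt ℝ 1 (fun p : E × E ↦ ((fderiv ℝ G p.1).flip p.2).flip p.2) p :=
    (hflip.contDiffAt.comp p ((hflip'.contDiffAt.comp p h1).clm_apply
      contDiffAt_snd)).clm_apply contDiffAt_snd
  exact hinv.clm_apply ((((h2.clm_apply contDiffAt_snd).add h3).sub h4).const_smul (2⁻¹ : ℝ))

end CoordMetric

/-! ### The Levi-Civita connection in coordinates -/

section LeviCivita

variable {E : Type*} [NormedAddCommGroup E] [NormedSpace ℝ E] [FiniteDimensional ℝ E]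
  {M : Type*} [TopologicalSpace M] [ChartedSpace E M] [IsManifold 𝓘(ℝ, E) ∞ M]
  [RiemannianBundle (fun x : M ↦ TangentSpace 𝓘(ℝ, E) x)]

/-- The coordinate expression of the metric in the chart at `x₀`. -/
def metricRep (x₀ : M) (u : E) : E →L[ℝ] E →L[ℝ] ℝ :=
  (innerSL ℝ (E := TangentSpace 𝓘(ℝ, E) ((extChartAt 𝓘(ℝ, E) x₀).symm u))).bilinearComp
    (frameL x₀ ((extChartAt 𝓘(ℝ, E) x₀).symm u)) (frameL x₀ ((extChartAt 𝓘(ℝ, E) x₀).symm u))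

lemma metricRep_apply (x₀ : M) (u a b : E) :
    metricRep x₀ u a b = inner ℝ (frameL x₀ ((extChartAt 𝓘(ℝ, E) x₀).symm u) a)
      (frameL x₀ ((extChartAt 𝓘(ℝ, E) x₀).symm u) b) := rfl

lemma metricRep_comm (x₀ : M) (u a b : E) : metricRep x₀ u a b = metricRep x₀ u b a := by
  rw [metricRep_apply, metricRep_apply, real_inner_comm]

lemma inner_eq_metricRep {x₀ y : M} (hy : y ∈ (extChartAt 𝓘(ℝ, E) x₀).source)
    (v w : TangentSpace 𝓘(ℝ, E) y) : (inner ℝ v w : ℝ) =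
      metricRep x₀ (extChartAt 𝓘(ℝ, E) x₀ y) (coordL x₀ y v) (coordL x₀ y w) := by
  rw [metricRep_apply, (extChartAt 𝓘(ℝ, E) x₀).left_inv hy, frameL_coordL hy, frameL_coordL hy]

lemma inner_field_eq_metricRep {x₀ : M} {u : E} (hu : u ∈ (extChartAt 𝓘(ℝ, E) x₀).target)
    (Y Z : ∀ x : M, TangentSpace 𝓘(ℝ, E) x) :
    (inner ℝ (Y ((extChartAt 𝓘(ℝ, E) x₀).symm u)) (Z ((extChartAt 𝓘(ℝ, E) x₀).symm u)) : ℝ) =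
      metricRep x₀ u (fieldRep x₀ Y u) (fieldRep x₀ Z u) := by
  rw [inner_eq_metricRep ((extChartAt 𝓘(ℝ, E) x₀).map_target hu),
    (extChartAt 𝓘(ℝ, E) x₀).right_inv hu]
  rfl

lemma metricRep_self_eq_zero {x₀ : M} {u : E} (hu : u ∈ (extChartAt 𝓘(ℝ, E) x₀).target) {a : E}
    (h : metricRep x₀ u a a = 0) : a = 0 := by
  rw [metricRep_apply, inner_self_eq_zero] at h
  rw [← coordL_frameL ((extChartAt 𝓘(ℝ, E) x₀).map_target hu) a, h, map_zero]

lemma metricRep_ext {x₀ : M} {u : E} (hu : u ∈ (extChartAt 𝓘(ℝ, E) x₀).target) {a b : E}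
    (h : ∀ c, metricRep x₀ u a c = metricRep x₀ u b c) : a = b := by
  refine sub_eq_zero.1 (metricRep_self_eq_zero hu (a := a - b) ?_)
  have := h (a - b)
  rw [map_sub (metricRep x₀ u), sub_apply, this, sub_self]

lemma isInvertible_metricRep {x₀ : M} {u : E} (hu : u ∈ (extChartAt 𝓘(ℝ, E) x₀).target) :
    (metricRep x₀ u).IsInvertible :=
  isInvertible_of_nondegenerate fun a ha ↦ metricRep_self_eq_zero hu (ha a)

variable [IsContMDiffRiemannianBundle 𝓘(ℝ, E) ∞ E (fun x : M ↦ TangentSpace 𝓘(ℝ, E) x)]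

lemma contDiffOn_metricRep (x₀ : M) :
    ContDiffOn ℝ ∞ (metricRep x₀) (extChartAt 𝓘(ℝ, E) x₀).target := by
  rw [contDiffOn_clm_apply]
  intro a
  rw [contDiffOn_clm_apply]
  intro b
  have h := ContMDiffOn.inner_bundle (E := fun x : M ↦ TangentSpace 𝓘(ℝ, E) x) (b := fun x ↦ x)
    (contMDiffOn_frameL x₀ a) (contMDiffOn_frameL x₀ b)
  exact contMDiffOn_iff_contDiffOn.1 (h.comp (contMDiffOn_extChartAt_symm x₀)
    fun u hu ↦ (extChartAt 𝓘(ℝ, E) x₀).map_target hu)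

lemma contDiffAt_metricRep {x₀ : M} {u : E} (hu : u ∈ (extChartAt 𝓘(ℝ, E) x₀).target) :
    ContDiffAt ℝ ∞ (metricRep x₀) u :=
  (contDiffOn_metricRep x₀).contDiffAt ((isOpen_extChartAt_target x₀).mem_nhds hu)

lemma hasFDerivAt_metricRep {x₀ : M} {u : E} (hu : u ∈ (extChartAt 𝓘(ℝ, E) x₀).target) :
    HasFDerivAt (metricRep x₀) (fderiv ℝ (metricRep x₀) u) u :=
  ((contDiffAt_metricRep hu).differentiableAt (by simp)).hasFDerivAt

lemma fderiv_metricRep_comm {x₀ : M} {u : E} (hu : u ∈ (extChartAt 𝓘(ℝ, E) x₀).target)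
    (a b c : E) : fderiv ℝ (metricRep x₀) u a b c = fderiv ℝ (metricRep x₀) u a c b :=
  fderiv_comm_of_symm (hasFDerivAt_metricRep hu).differentiableAt (metricRep_comm x₀) a b c

lemma metricRep_christoffel {x₀ : M} {u : E} (hu : u ∈ (extChartAt 𝓘(ℝ, E) x₀).target)
    (a b c : E) : metricRep x₀ u (christoffel (metricRep x₀) u a b) c =
      2⁻¹ * (fderiv ℝ (metricRep x₀) u a b c + fderiv ℝ (metricRep x₀) u b c a
        - fderiv ℝ (metricRep x₀) u c a b) :=
  apply_christoffel (isInvertible_metricRep hu) a b c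

/-- The Christoffel symbols are compatible with the metric. -/
lemma fderiv_metricRep_eq {x₀ : M} {u : E} (hu : u ∈ (extChartAt 𝓘(ℝ, E) x₀).target)
    (a b c : E) : fderiv ℝ (metricRep x₀) u a b c =
      metricRep x₀ u (christoffel (metricRep x₀) u a b) c
        + metricRep x₀ u b (christoffel (metricRep x₀) u a c) := by
  rw [metricRep_comm x₀ u b, metricRep_christoffel hu, metricRep_christoffel hu,
    fderiv_metricRep_comm hu a c b, fderiv_metricRep_comm hu b c a, fderiv_metricRep_comm hu c a b]
  ring

lemma christoffel_add_right {x₀ : M} {u : E} (hu : u ∈ (extChartAt 𝓘(ℝ, E) x₀).target)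
    (a b b' : E) : christoffel (metricRep x₀) u a (b + b') =
      christoffel (metricRep x₀) u a b + christoffel (metricRep x₀) u a b' := by
  refine metricRep_ext hu fun c ↦ ?_
  simp only [metricRep_christoffel hu, map_add, add_apply]
  ring

lemma christoffel_add_left {x₀ : M} {u : E} (hu : u ∈ (extChartAt 𝓘(ℝ, E) x₀).target)
    (a a' b : E) : christoffel (metricRep x₀) u (a + a') b =
      christoffel (metricRep x₀) u a b + christoffel (metricRep x₀) u a' b := by
  refine metricRep_ext hu fun c ↦ ?_
  simp only [metricRep_christoffel hu, map_add, add_apply]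
  ring

lemma dirDeriv_inner {x₀ y : M} (hy : y ∈ (extChartAt 𝓘(ℝ, E) x₀).source)
    {Y Z : ∀ x : M, TangentSpace 𝓘(ℝ, E) x}
    (hY : DifferentiableAt ℝ (fieldRep x₀ Y) (extChartAt 𝓘(ℝ, E) x₀ y))
    (hZ : DifferentiableAt ℝ (fieldRep x₀ Z) (extChartAt 𝓘(ℝ, E) x₀ y))
    (v : TangentSpace 𝓘(ℝ, E) y) :
    dirDeriv (fun y ↦ inner ℝ (Y y) (Z y)) y v =
      fderiv ℝ (metricRep x₀) (extChartAt 𝓘(ℝ, E) x₀ y) (coordL x₀ y v)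
          (coordL x₀ y (Y y)) (coordL x₀ y (Z y))
        + metricRep x₀ (extChartAt 𝓘(ℝ, E) x₀ y)
          (fderiv ℝ (fieldRep x₀ Y) (extChartAt 𝓘(ℝ, E) x₀ y) (coordL x₀ y v)) (coordL x₀ y (Z y))
        + metricRep x₀ (extChartAt 𝓘(ℝ, E) x₀ y) (coordL x₀ y (Y y))
          (fderiv ℝ (fieldRep x₀ Z) (extChartAt 𝓘(ℝ, E) x₀ y) (coordL x₀ y v)) := by
  have hu := (extChartAt 𝓘(ℝ, E) x₀).map_source hy
  have h := ((hasFDerivAt_metricRep hu).clm_apply hY.hasFDerivAt).clm_apply hZ.hasFDerivAt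
  have e : (fun y ↦ (inner ℝ (Y y) (Z y) : ℝ)) ∘ (extChartAt 𝓘(ℝ, E) x₀).symm
      =ᶠ[𝓝 (extChartAt 𝓘(ℝ, E) x₀ y)]
        fun u ↦ metricRep x₀ u (fieldRep x₀ Y u) (fieldRep x₀ Z u) := by
    filter_upwards [target_mem_nhds hy] with u hu using inner_field_eq_metricRep hu Y Z
  have h' := h.congr_of_eventuallyEq e
  rw [dirDeriv_eq hy h'.differentiableAt, h'.fderiv]
  simp only [add_apply, ContinuousLinearMap.comp_apply,
    ContinuousLinearMap.flip_apply, fieldRep_apply hy]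
  ring

/-- In coordinates, the Koszul expression is `2 g(∂_X Y + Γ(X, Y), Z)`. -/
lemma koszul_eq {x₀ y : M} (hy : y ∈ (extChartAt 𝓘(ℝ, E) x₀).source)
    {X Y Z : ∀ x : M, TangentSpace 𝓘(ℝ, E) x}
    (hX : DifferentiableAt ℝ (fieldRep x₀ X) (extChartAt 𝓘(ℝ, E) x₀ y))
    (hY : DifferentiableAt ℝ (fieldRep x₀ Y) (extChartAt 𝓘(ℝ, E) x₀ y))
    (hZ : DifferentiableAt ℝ (fieldRep x₀ Z) (extChartAt 𝓘(ℝ, E) x₀ y)) :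
    koszul X Y Z y = 2 * metricRep x₀ (extChartAt 𝓘(ℝ, E) x₀ y)
      (fderiv ℝ (fieldRep x₀ Y) (extChartAt 𝓘(ℝ, E) x₀ y) (coordL x₀ y (X y))
        + christoffel (metricRep x₀) (extChartAt 𝓘(ℝ, E) x₀ y) (coordL x₀ y (X y))
          (coordL x₀ y (Y y)))
      (coordL x₀ y (Z y)) := by
  have hu := (extChartAt 𝓘(ℝ, E) x₀).map_source hy
  rw [koszul, dirDeriv_inner hy hY hZ, dirDeriv_inner hy hZ hX, dirDeriv_inner hy hX hY,
    inner_eq_metricRep hy (VectorField.mlieBracket 𝓘(ℝ, E) X Y y),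
    inner_eq_metricRep hy (VectorField.mlieBracket 𝓘(ℝ, E) Y Z y),
    inner_eq_metricRep hy (VectorField.mlieBracket 𝓘(ℝ, E) Z X y),
    coordL_mlieBracket hy hX hY, coordL_mlieBracket hy hY hZ, coordL_mlieBracket hy hZ hX]
  simp only [map_add, map_sub, add_apply, sub_apply,
    metricRep_christoffel hu]
  rw [metricRep_comm x₀ _ (coordL x₀ y (Y y)), metricRep_comm x₀ _ (coordL x₀ y (Z y)),
    metricRep_comm x₀ _ (coordL x₀ y (X y))]
  ring

/-- The covariant derivative in coordinates. -/
lemma coordL_nabla {x₀ y : M} (hy : y ∈ (extChartAt 𝓘(ℝ, E) x₀).source)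
    {Y : ∀ x : M, TangentSpace 𝓘(ℝ, E) x}
    (hY : DifferentiableAt ℝ (fieldRep x₀ Y) (extChartAt 𝓘(ℝ, E) x₀ y))
    (v : TangentSpace 𝓘(ℝ, E) y) :
    coordL x₀ y (nabla Y y v) =
      fderiv ℝ (fieldRep x₀ Y) (extChartAt 𝓘(ℝ, E) x₀ y) (coordL x₀ y v)
        + christoffel (metricRep x₀) (extChartAt 𝓘(ℝ, E) x₀ y) (coordL x₀ y v)
          (coordL x₀ y (Y y)) := by
  set w := fderiv ℝ (fieldRep x₀ Y) (extChartAt 𝓘(ℝ, E) x₀ y) (coordL x₀ y v)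
        + christoffel (metricRep x₀) (extChartAt 𝓘(ℝ, E) x₀ y) (coordL x₀ y v)
          (coordL x₀ y (Y y)) with hw
  -- the Koszul expression in the definition of `nabla` represents the vector with coordinates `w`
  have hext (z : TangentSpace 𝓘(ℝ, E) y) :
      DifferentiableAt ℝ (fieldRep x₀ (FiberBundle.extend E z)) (extChartAt 𝓘(ℝ, E) x₀ y) :=
    (mdifferentiableAt_field_iff hy _).1 (FiberBundle.mdifferentiableAt_extend 𝓘(ℝ, E) E z)
  have hk (z : TangentSpace 𝓘(ℝ, E) y) :
      koszul (FiberBundle.extend E v) Y (FiberBundle.extend E z) y / 2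
        = inner ℝ z (frameL x₀ y w) := by
    rw [koszul_eq hy (hext v) hY (hext z), real_inner_comm, inner_eq_metricRep hy,
      coordL_frameL hy, FiberBundle.extend_apply_self, FiberBundle.extend_apply_self, hw]
    ring
  rw [nabla]
  simp_rw [hk]
  rw [(stdOrthonormalBasis ℝ (TangentSpace 𝓘(ℝ, E) y)).sum_repr', coordL_frameL hy]

lemma inner_grad (f : M → ℝ) (x : M) (v : TangentSpace 𝓘(ℝ, E) x) :
    (inner ℝ (grad f x) v : ℝ) = dirDeriv f x v := by
  rw [grad, sum_inner]
  simp_rw [inner_smul_left]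
  conv_rhs => rw [← (stdOrthonormalBasis ℝ (TangentSpace 𝓘(ℝ, E) x)).sum_repr' v]
  rw [dirDeriv, map_sum]
  refine Finset.sum_congr rfl fun i _ ↦ ?_
  rw [map_smul, smul_eq_mul, mul_comm]
  rfl

end LeviCivita

/-! ### Vector fields along curves -/

section Along

variable {E : Type*} [NormedAddCommGroup E] [NormedSpace ℝ E] [FiniteDimensional ℝ E]
  {M : Type*} [TopologicalSpace M] [ChartedSpace E M] [IsManifold 𝓘(ℝ, E) ∞ M]

/-- The coordinate expression, in the chart at `x₀`, of a vector field along a curve. -/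
def alongRep (x₀ : M) (α : ℝ → M) (W : ∀ t, TangentSpace 𝓘(ℝ, E) (α t)) (t : ℝ) : E :=
  coordL x₀ (α t) (W t)

/-- Differentiability at `t` of a vector field along the curve `α`, in the chart at `α t`. -/
def DiffAlong (α : ℝ → M) (W : ∀ t, TangentSpace 𝓘(ℝ, E) (α t)) (t : ℝ) : Prop :=
  DifferentiableAt ℝ (alongRep (α t) α W) t

lemma eventually_mem_source {x₀ : M} {α : ℝ → M} {t : ℝ} (hα : ContinuousAt α t)
    (ht : α t ∈ (extChartAt 𝓘(ℝ, E) x₀).source) :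
    ∀ᶠ s in 𝓝 t, α s ∈ (extChartAt 𝓘(ℝ, E) x₀).source :=
  hα.eventually ((isOpen_extChartAt_source x₀).mem_nhds ht)

lemma hasDerivAt_chart_comp {x₀ : M} {α : ℝ → M} {t : ℝ}
    (hα : MDifferentiableAt 𝓘(ℝ, ℝ) 𝓘(ℝ, E) α t)
    (ht : α t ∈ (extChartAt 𝓘(ℝ, E) x₀).source) :
    HasDerivAt (extChartAt 𝓘(ℝ, E) x₀ ∘ α) (coordL x₀ (α t) (velocity α t)) t := by
  have hφ : MDifferentiableAt 𝓘(ℝ, E) 𝓘(ℝ, E) (extChartAt 𝓘(ℝ, E) x₀) (α t) :=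
    (contMDiffAt_chart ht).mdifferentiableAt (by simp)
  have hd : DifferentiableAt ℝ (extChartAt 𝓘(ℝ, E) x₀ ∘ α) t :=
    (hφ.comp t hα).differentiableAt
  have h := mfderiv_comp t hφ hα
  rw [mfderiv_eq_fderiv, ← coordL_eq_mfderiv ht] at h
  have h1 := congrArg (fun L ↦ L (1 : ℝ)) h
  have h2 : deriv (extChartAt 𝓘(ℝ, E) x₀ ∘ α) t = coordL x₀ (α t) (velocity α t) := by
    rw [← fderiv_apply_one_eq_deriv]
    exact h1
  rw [← h2]
  exact hd.hasDerivAt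

lemma fieldRep_frameL_eq {x₀ : M} {u : E} (hu : u ∈ (extChartAt 𝓘(ℝ, E) x₀).target) (a : E) :
    fieldRep x₀ (fun y ↦ frameL x₀ y a) u = a :=
  coordL_frameL ((extChartAt 𝓘(ℝ, E) x₀).map_target hu) a

lemma fieldRep_frameL_eventuallyEq {x₀ y : M} (hy : y ∈ (extChartAt 𝓘(ℝ, E) x₀).source) (a : E) :
    fieldRep x₀ (fun y ↦ frameL x₀ y a) =ᶠ[𝓝 (extChartAt 𝓘(ℝ, E) x₀ y)] fun _ ↦ a := by
  filter_upwards [target_mem_nhds hy] with u hu using fieldRep_frameL_eq hu a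

lemma extend_eq_frameL {x y : M} (hy : y ∈ (extChartAt 𝓘(ℝ, E) x).source)
    (v : TangentSpace 𝓘(ℝ, E) x) : FiberBundle.extend E v y = frameL x y (coordL x x v) := by
  rw [coordL_eq_snd (mem_extChartAt_source x), frameL_apply hy]
  rfl

/-- The extension of `v` has constant coordinates in the chart at the base point. -/
lemma fieldRep_extend_eventuallyEq {x : M} (v : TangentSpace 𝓘(ℝ, E) x) :
    fieldRep x (FiberBundle.extend E v) =ᶠ[𝓝 (extChartAt 𝓘(ℝ, E) x x)] fun _ ↦ coordL x x v := by
  filter_upwards [target_mem_nhds (mem_extChartAt_source x)] with u hu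
  have hy := (extChartAt 𝓘(ℝ, E) x).map_target hu
  rw [fieldRep, extend_eq_frameL hy, coordL_frameL hy]

/-- The change of frame from the chart at `x₀` to the chart at `x₁`, in the chart at `x₁`. -/
def frameChange (x₀ x₁ : M) (u : E) : E →L[ℝ] E :=
  (coordL x₁ ((extChartAt 𝓘(ℝ, E) x₁).symm u)).comp (frameL x₀ ((extChartAt 𝓘(ℝ, E) x₁).symm u))

lemma differentiableAt_frameChange {x₀ x₁ y : M} (h₀ : y ∈ (extChartAt 𝓘(ℝ, E) x₀).source)
    (h₁ : y ∈ (extChartAt 𝓘(ℝ, E) x₁).source) :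
    DifferentiableAt ℝ (frameChange (E := E) x₀ x₁) (extChartAt 𝓘(ℝ, E) x₁ y) := by
  set O : Set E := (extChartAt 𝓘(ℝ, E) x₁).target ∩
    (extChartAt 𝓘(ℝ, E) x₁).symm ⁻¹' (extChartAt 𝓘(ℝ, E) x₀).source with hO
  have hOo : IsOpen O := (continuousOn_extChartAt_symm x₁).isOpen_inter_preimage
    (isOpen_extChartAt_target x₁) (isOpen_extChartAt_source x₀)
  have hy : extChartAt 𝓘(ℝ, E) x₁ y ∈ O := by
    refine ⟨(extChartAt 𝓘(ℝ, E) x₁).map_source h₁, ?_⟩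
    rwa [mem_preimage, (extChartAt 𝓘(ℝ, E) x₁).left_inv h₁]
  suffices h : ContDiffOn ℝ 1 (frameChange (E := E) x₀ x₁) O from
    (h.contDiffAt (hOo.mem_nhds hy)).differentiableAt one_ne_zero
  rw [contDiffOn_clm_apply]
  intro a
  have h1 : ContMDiffOn 𝓘(ℝ, E) 𝓘(ℝ, E) 1 (fun z ↦ coordL x₁ z (frameL x₀ z a))
      ((extChartAt 𝓘(ℝ, E) x₀).source ∩ (extChartAt 𝓘(ℝ, E) x₁).source) := by
    intro z hz
    have h2 := (((contMDiffOn_frameL x₀ a) z hz.1).mono inter_subset_left (t :=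
      (extChartAt 𝓘(ℝ, E) x₀).source ∩ (extChartAt 𝓘(ℝ, E) x₁).source)).of_le
      (m := 1) (WithTop.coe_le_coe.2 le_top)
    rw [Trivialization.contMDiffWithinAt_section (IB := 𝓘(ℝ, E))
      (e := trivializationAt E (TangentSpace 𝓘(ℝ, E) : M → Type _) x₁) _
      (mem_baseSet_of_mem_source hz.2)] at h2
    exact h2.congr_of_mem (fun w hw ↦ coordL_eq_snd hw.2 _) hz
  have h3 := h1.comp (t := (extChartAt 𝓘(ℝ, E) x₀).source ∩ (extChartAt 𝓘(ℝ, E) x₁).source)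
    (s := O) ((contMDiffOn_extChartAt_symm (n := 1) x₁).mono inter_subset_left)
    fun u hu ↦ ⟨hu.2, (extChartAt 𝓘(ℝ, E) x₁).map_target hu.1⟩
  exact contMDiffOn_iff_contDiffOn.1 h3

lemma alongRep_eq_frameChange {x₀ x₁ : M} {α : ℝ → M} {t : ℝ}
    (h₀ : α t ∈ (extChartAt 𝓘(ℝ, E) x₀).source) (h₁ : α t ∈ (extChartAt 𝓘(ℝ, E) x₁).source)
    (W : ∀ t, TangentSpace 𝓘(ℝ, E) (α t)) :
    alongRep x₁ α W t =
      frameChange x₀ x₁ (extChartAt 𝓘(ℝ, E) x₁ (α t)) (alongRep x₀ α W t) := by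
  rw [frameChange, (extChartAt 𝓘(ℝ, E) x₁).left_inv h₁, ContinuousLinearMap.comp_apply, alongRep,
    alongRep, frameL_coordL h₀]

/-- How the derivative of the coordinates of a field along a curve changes with the chart. -/
lemma hasDerivAt_alongRep {x₀ x₁ : M} {α : ℝ → M} {t : ℝ}
    (hα : MDifferentiableAt 𝓘(ℝ, ℝ) 𝓘(ℝ, E) α t)
    (h₀ : α t ∈ (extChartAt 𝓘(ℝ, E) x₀).source) (h₁ : α t ∈ (extChartAt 𝓘(ℝ, E) x₁).source)
    {W : ∀ t, TangentSpace 𝓘(ℝ, E) (α t)} (hW : DifferentiableAt ℝ (alongRep x₀ α W) t) :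
    HasDerivAt (alongRep x₁ α W)
      (fderiv ℝ (frameChange x₀ x₁) (extChartAt 𝓘(ℝ, E) x₁ (α t))
          (coordL x₁ (α t) (velocity α t)) (alongRep x₀ α W t)
        + frameChange x₀ x₁ (extChartAt 𝓘(ℝ, E) x₁ (α t)) (deriv (alongRep x₀ α W) t)) t := by
  have h1 := (differentiableAt_frameChange h₀ h₁).hasFDerivAt.comp_hasDerivAt t
    (hasDerivAt_chart_comp hα h₁)
  refine (h1.clm_apply hW.hasDerivAt).congr_of_eventuallyEq ?_
  filter_upwards [eventually_mem_source hα.continuousAt h₀,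
    eventually_mem_source hα.continuousAt h₁] with s hs₀ hs₁
  exact alongRep_eq_frameChange hs₀ hs₁ W

lemma DiffAlong.add {α : ℝ → M} {t : ℝ} {W₁ W₂ : ∀ t, TangentSpace 𝓘(ℝ, E) (α t)}
    (h₁ : DiffAlong α W₁ t) (h₂ : DiffAlong α W₂ t) : DiffAlong α (fun s ↦ W₁ s + W₂ s) t := by
  refine (DifferentiableAt.add h₁ h₂).congr_of_eventuallyEq (Eventually.of_forall fun s ↦ ?_)
  exact map_add (coordL (α t) (α s)) _ _

variable [RiemannianBundle (fun x : M ↦ TangentSpace 𝓘(ℝ, E) x)]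
  [IsContMDiffRiemannianBundle 𝓘(ℝ, E) ∞ E (fun x : M ↦ TangentSpace 𝓘(ℝ, E) x)]

/-- The covariant derivative along a curve, in the coordinates of an arbitrary chart. -/
lemma coordL_covDerivAlong {x₀ : M} {α : ℝ → M} {t : ℝ}
    (hα : MDifferentiableAt 𝓘(ℝ, ℝ) 𝓘(ℝ, E) α t)
    (h₀ : α t ∈ (extChartAt 𝓘(ℝ, E) x₀).source)
    {W : ∀ t, TangentSpace 𝓘(ℝ, E) (α t)} (hW : DifferentiableAt ℝ (alongRep x₀ α W) t) :
    coordL x₀ (α t) (covDerivAlong α W t) = deriv (alongRep x₀ α W) t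
      + christoffel (metricRep x₀) (extChartAt 𝓘(ℝ, E) x₀ (α t)) (coordL x₀ (α t) (velocity α t))
        (alongRep x₀ α W t) := by
  have h₁ : α t ∈ (extChartAt 𝓘(ℝ, E) (α t)).source := mem_extChartAt_source _
  set v := velocity (E := E) α t with hv
  set w := alongRep x₀ α W t with hw
  -- the field with constant coordinates `w` in the chart at `x₀`
  set Y : ∀ x : M, TangentSpace 𝓘(ℝ, E) x := fun y ↦ frameL x₀ y w with hY
  have hY₀ := fieldRep_frameL_eventuallyEq h₀ w
  have hY₀d : DifferentiableAt ℝ (fieldRep x₀ Y) (extChartAt 𝓘(ℝ, E) x₀ (α t)) :=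
    (differentiableAt_const w).congr_of_eventuallyEq hY₀
  have hY₁d : DifferentiableAt ℝ (fieldRep (α t) Y) (extChartAt 𝓘(ℝ, E) (α t) (α t)) :=
    (mdifferentiableAt_field_iff h₁ Y).1 ((mdifferentiableAt_field_iff h₀ Y).2 hY₀d)
  have hYt : Y (α t) = W t := frameL_coordL h₀ (W t)
  have hder : fderiv ℝ (fieldRep (α t) Y) (extChartAt 𝓘(ℝ, E) (α t) (α t)) (coordL (α t) (α t) v)
      = fderiv ℝ (frameChange x₀ (α t)) (extChartAt 𝓘(ℝ, E) (α t) (α t))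
        (coordL (α t) (α t) v) w := by
    have h := (differentiableAt_frameChange h₀ h₁).hasFDerivAt.clm_apply
      (hasFDerivAt_const w (extChartAt 𝓘(ℝ, E) (α t) (α t)))
    have e : fieldRep (α t) Y = fun u ↦ frameChange x₀ (α t) u w := rfl
    rw [e, h.fderiv]
    simp
  have hcov : covDerivAlong α W t =
      frameL x₀ (α t) (deriv (alongRep x₀ α W) t) + nabla Y (α t) v := by
    have hsymm : (trivializationAt E (TangentSpace 𝓘(ℝ, E) : M → Type _) (α t)).symm (α t)
        (deriv (fun s ↦ (trivializationAt E (TangentSpace 𝓘(ℝ, E) : M → Type _) (α t)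
          (TotalSpace.mk' E (α s) (W s))).2) t)
        = frameL (α t) (α t) (deriv (alongRep (α t) α W) t) := by
      have e : (fun s ↦ (trivializationAt E (TangentSpace 𝓘(ℝ, E) : M → Type _) (α t)
          (TotalSpace.mk' E (α s) (W s))).2) =ᶠ[𝓝 t] alongRep (α t) α W := by
        filter_upwards [eventually_mem_source hα.continuousAt h₁] with s hs
        exact (coordL_eq_snd hs _).symm
      rw [e.deriv_eq, frameL_apply h₁]
    rw [covDerivAlong, hsymm]
    refine coordL_injective h₁ ?_
    have hext : DifferentiableAt ℝ (fieldRep (α t) (FiberBundle.extend E (W t)))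
        (extChartAt 𝓘(ℝ, E) (α t) (α t)) :=
      (differentiableAt_const _).congr_of_eventuallyEq (fieldRep_extend_eventuallyEq _)
    have hext0 : fderiv ℝ (fieldRep (α t) (FiberBundle.extend E (W t)))
        (extChartAt 𝓘(ℝ, E) (α t) (α t)) = 0 := by
      rw [(fieldRep_extend_eventuallyEq _).fderiv_eq, fderiv_const_apply]
    rw [map_add, map_add, coordL_frameL h₁, coordL_nabla h₁ hext, coordL_nabla h₁ hY₁d, hYt, hder,
      hext0, (hasDerivAt_alongRep hα h₀ h₁ hW).deriv, FiberBundle.extend_apply_self,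
      frameChange, (extChartAt 𝓘(ℝ, E) (α t)).left_inv h₁, ContinuousLinearMap.comp_apply,
      zero_apply, zero_add]
    rw [add_comm (fderiv ℝ (frameChange x₀ (α t)) _ _ _), add_assoc]
  rw [hcov, map_add, coordL_frameL h₀, coordL_nabla h₀ hY₀d, hY₀.fderiv_eq, hYt,
    fderiv_const_apply, zero_apply, zero_add]
  rfl

lemma covDerivAlong_add {α : ℝ → M} {t : ℝ} (hα : MDifferentiableAt 𝓘(ℝ, ℝ) 𝓘(ℝ, E) α t)
    {W₁ W₂ : ∀ t, TangentSpace 𝓘(ℝ, E) (α t)}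
    (h₁ : DiffAlong α W₁ t) (h₂ : DiffAlong α W₂ t) :
    covDerivAlong α (fun s ↦ W₁ s + W₂ s) t = covDerivAlong α W₁ t + covDerivAlong α W₂ t := by
  have h₀ : α t ∈ (extChartAt 𝓘(ℝ, E) (α t)).source := mem_extChartAt_source _
  refine coordL_injective h₀ ?_
  have e : alongRep (α t) α (fun s ↦ W₁ s + W₂ s)
      = fun s ↦ alongRep (α t) α W₁ s + alongRep (α t) α W₂ s :=
    funext fun s ↦ map_add (coordL (α t) (α s)) _ _
  rw [map_add, coordL_covDerivAlong hα h₀ (h₁.add h₂), coordL_covDerivAlong hα h₀ h₁,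
    coordL_covDerivAlong hα h₀ h₂, e, deriv_fun_add h₁ h₂,
    christoffel_add_right ((extChartAt 𝓘(ℝ, E) (α t)).map_source h₀)]
  abel

/-- The Levi-Civita connection is metric along curves. -/
lemma hasDerivAt_inner_along {α : ℝ → M} {t : ℝ} (hα : MDifferentiableAt 𝓘(ℝ, ℝ) 𝓘(ℝ, E) α t)
    {W₁ W₂ : ∀ t, TangentSpace 𝓘(ℝ, E) (α t)}
    (h₁ : DiffAlong α W₁ t) (h₂ : DiffAlong α W₂ t) :
    HasDerivAt (fun s ↦ (inner ℝ (W₁ s) (W₂ s) : ℝ))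
      (inner ℝ (covDerivAlong α W₁ t) (W₂ t) + inner ℝ (W₁ t) (covDerivAlong α W₂ t)) t := by
  have h₀ : α t ∈ (extChartAt 𝓘(ℝ, E) (α t)).source := mem_extChartAt_source _
  have hu := (extChartAt 𝓘(ℝ, E) (α t)).map_source h₀
  have hG := (hasFDerivAt_metricRep hu).comp_hasDerivAt t (hasDerivAt_chart_comp hα h₀)
  have h := (hG.clm_apply h₁.hasDerivAt).clm_apply h₂.hasDerivAt
  have e : (fun s ↦ (inner ℝ (W₁ s) (W₂ s) : ℝ)) =ᶠ[𝓝 t] fun s ↦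
      metricRep (α t) (extChartAt 𝓘(ℝ, E) (α t) (α s)) (alongRep (α t) α W₁ s)
        (alongRep (α t) α W₂ s) := by
    filter_upwards [eventually_mem_source hα.continuousAt h₀] with s hs
    exact inner_eq_metricRep hs _ _
  refine (h.congr_of_eventuallyEq e).congr_deriv ?_
  rw [inner_eq_metricRep h₀, inner_eq_metricRep h₀, coordL_covDerivAlong hα h₀ h₁,
    coordL_covDerivAlong hα h₀ h₂]
  simp only [map_add, add_apply, fderiv_metricRep_eq hu, Function.comp]
  simp only [alongRep]
  ring

end Along

/-! ### Fields of endomorphisms -/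

section Endomorphism

variable {E : Type*} [NormedAddCommGroup E] [NormedSpace ℝ E] [FiniteDimensional ℝ E]
  {M : Type*} [TopologicalSpace M] [ChartedSpace E M] [IsManifold 𝓘(ℝ, E) ∞ M]

/-- The coordinate expression, in the chart at `x₀`, of a field of endomorphisms of the tangent
spaces. -/
def endRep (x₀ : M) (P : ∀ x : M, TangentSpace 𝓘(ℝ, E) x →L[ℝ] TangentSpace 𝓘(ℝ, E) x) (u : E) :
    E →L[ℝ] E :=
  (coordL x₀ ((extChartAt 𝓘(ℝ, E) x₀).symm u)).comp
    ((P ((extChartAt 𝓘(ℝ, E) x₀).symm u)).comp (frameL x₀ ((extChartAt 𝓘(ℝ, E) x₀).symm u)))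

/-- A field of endomorphisms is differentiable at `x` if its expression in the chart at `x` is. -/
def DiffEndAt (P : ∀ x : M, TangentSpace 𝓘(ℝ, E) x →L[ℝ] TangentSpace 𝓘(ℝ, E) x) (x : M) : Prop :=
  DifferentiableAt ℝ (endRep x P) (extChartAt 𝓘(ℝ, E) x x)

variable {P : ∀ x : M, TangentSpace 𝓘(ℝ, E) x →L[ℝ] TangentSpace 𝓘(ℝ, E) x}

lemma coordL_end_apply {x₀ y : M} (hy : y ∈ (extChartAt 𝓘(ℝ, E) x₀).source)
    (v : TangentSpace 𝓘(ℝ, E) y) :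
    coordL x₀ y (P y v) = endRep x₀ P (extChartAt 𝓘(ℝ, E) x₀ y) (coordL x₀ y v) := by
  rw [endRep, (extChartAt 𝓘(ℝ, E) x₀).left_inv hy, ContinuousLinearMap.comp_apply,
    ContinuousLinearMap.comp_apply, frameL_coordL hy]

lemma fieldRep_end_apply {x₀ : M} {u : E} (hu : u ∈ (extChartAt 𝓘(ℝ, E) x₀).target)
    (Y : ∀ x : M, TangentSpace 𝓘(ℝ, E) x) :
    fieldRep x₀ (fun y ↦ P y (Y y)) u = endRep x₀ P u (fieldRep x₀ Y u) := by
  rw [fieldRep, coordL_end_apply ((extChartAt 𝓘(ℝ, E) x₀).map_target hu),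
    (extChartAt 𝓘(ℝ, E) x₀).right_inv hu]
  rfl

lemma hasDerivAt_alongRep_end {α : ℝ → M} {t : ℝ} (hP : DiffEndAt P (α t))
    (hα : MDifferentiableAt 𝓘(ℝ, ℝ) 𝓘(ℝ, E) α t)
    {W : ∀ t, TangentSpace 𝓘(ℝ, E) (α t)} (hW : DiffAlong α W t) :
    HasDerivAt (alongRep (α t) α fun s ↦ P (α s) (W s))
      (fderiv ℝ (endRep (α t) P) (extChartAt 𝓘(ℝ, E) (α t) (α t))
          (coordL (α t) (α t) (velocity α t)) (alongRep (α t) α W t)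
        + endRep (α t) P (extChartAt 𝓘(ℝ, E) (α t) (α t)) (deriv (alongRep (α t) α W) t)) t := by
  have h₀ : α t ∈ (extChartAt 𝓘(ℝ, E) (α t)).source := mem_extChartAt_source _
  have h1 := hP.hasFDerivAt.comp_hasDerivAt t (hasDerivAt_chart_comp hα h₀)
  refine (h1.clm_apply hW.hasDerivAt).congr_of_eventuallyEq ?_
  filter_upwards [eventually_mem_source hα.continuousAt h₀] with s hs
  exact coordL_end_apply hs (W s)

lemma DiffAlong.end_apply {α : ℝ → M} {t : ℝ} (hP : DiffEndAt P (α t))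
    (hα : MDifferentiableAt 𝓘(ℝ, ℝ) 𝓘(ℝ, E) α t)
    {W : ∀ t, TangentSpace 𝓘(ℝ, E) (α t)} (hW : DiffAlong α W t) :
    DiffAlong α (fun s ↦ P (α s) (W s)) t :=
  (hasDerivAt_alongRep_end hP hα hW).differentiableAt

variable [RiemannianBundle (fun x : M ↦ TangentSpace 𝓘(ℝ, E) x)]
  [IsContMDiffRiemannianBundle 𝓘(ℝ, E) ∞ E (fun x : M ↦ TangentSpace 𝓘(ℝ, E) x)]

/-- `(∇_v P) Y = ∇_v (P Y) - P (∇_v Y)` in coordinates; it depends on `Y` through its value at `x`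
only. -/
lemma coordL_nabla_end_sub {x : M} (hP : DiffEndAt P x) {Y : ∀ x : M, TangentSpace 𝓘(ℝ, E) x}
    (hY : DifferentiableAt ℝ (fieldRep x Y) (extChartAt 𝓘(ℝ, E) x x))
    (v : TangentSpace 𝓘(ℝ, E) x) :
    coordL x x (nabla (fun y ↦ P y (Y y)) x v - P x (nabla Y x v)) =
      fderiv ℝ (endRep x P) (extChartAt 𝓘(ℝ, E) x x) (coordL x x v) (coordL x x (Y x))
      + christoffel (metricRep x) (extChartAt 𝓘(ℝ, E) x x) (coordL x x v) (coordL x x (P x (Y x)))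
      - endRep x P (extChartAt 𝓘(ℝ, E) x x)
        (christoffel (metricRep x) (extChartAt 𝓘(ℝ, E) x x) (coordL x x v) (coordL x x (Y x))) := by
  have hx : x ∈ (extChartAt 𝓘(ℝ, E) x).source := mem_extChartAt_source _
  have h : HasFDerivAt (fieldRep x fun y ↦ P y (Y y)) _ (extChartAt 𝓘(ℝ, E) x x) :=
    (hP.hasFDerivAt.clm_apply hY.hasFDerivAt).congr_of_eventuallyEq (by
      filter_upwards [target_mem_nhds hx] with u hu using fieldRep_end_apply hu Y)
  rw [map_sub, coordL_nabla hx h.differentiableAt, coordL_end_apply hx (nabla Y x v),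
    coordL_nabla hx hY, h.fderiv, map_add]
  simp only [add_apply, ContinuousLinearMap.comp_apply, ContinuousLinearMap.flip_apply,
    fieldRep_apply hx]
  abel

/-- The Leibniz rule for the covariant derivative of `P W` along a curve. The derivative of `P` is
written with a field `Y` extending `W t`; any extension will do. -/
lemma covDerivAlong_end {α : ℝ → M} {t : ℝ} (hP : DiffEndAt P (α t))
    (hα : MDifferentiableAt 𝓘(ℝ, ℝ) 𝓘(ℝ, E) α t)
    {W : ∀ t, TangentSpace 𝓘(ℝ, E) (α t)} (hW : DiffAlong α W t)
    {Y : ∀ x : M, TangentSpace 𝓘(ℝ, E) x}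
    (hY : DifferentiableAt ℝ (fieldRep (α t) Y) (extChartAt 𝓘(ℝ, E) (α t) (α t)))
    (hYW : Y (α t) = W t) :
    covDerivAlong α (fun s ↦ P (α s) (W s)) t =
      (nabla (fun y ↦ P y (Y y)) (α t) (velocity α t) - P (α t) (nabla Y (α t) (velocity α t)))
        + P (α t) (covDerivAlong α W t) := by
  have h₀ : α t ∈ (extChartAt 𝓘(ℝ, E) (α t)).source := mem_extChartAt_source _
  refine coordL_injective h₀ ?_
  rw [map_add, coordL_nabla_end_sub hP hY, coordL_end_apply h₀ (covDerivAlong α W t),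
    coordL_covDerivAlong hα h₀ hW, coordL_covDerivAlong hα h₀ (hW.end_apply hP hα),
    (hasDerivAt_alongRep_end hP hα hW).deriv, map_add, hYW]
  simp only [alongRep]
  abel

lemma differentiableAt_fieldRep_extend {x : M} (w : TangentSpace 𝓘(ℝ, E) x) :
    DifferentiableAt ℝ (fieldRep x (FiberBundle.extend E w)) (extChartAt 𝓘(ℝ, E) x x) :=
  (differentiableAt_const _).congr_of_eventuallyEq (fieldRep_extend_eventuallyEq w)

lemma IsSmoothField.differentiableAt_fieldRep {Y : ∀ x : M, TangentSpace 𝓘(ℝ, E) x}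
    (hY : IsSmoothField Y) (x : M) :
    DifferentiableAt ℝ (fieldRep x Y) (extChartAt 𝓘(ℝ, E) x x) :=
  (mdifferentiableAt_field_iff (mem_extChartAt_source x) Y).1 (hY.mdifferentiable (by simp) x)

namespace AlmostContactMetric

lemma diffEndAt_φ (S : AlmostContactMetric E M) (x : M) : DiffEndAt S.φ x := by
  have h := (contMDiffAt_hom_bundle _).1 (S.φ_smooth x)
  have h2 := (mdifferentiableAt_iff_comp_symm (mem_extChartAt_source x) _).1
    (h.2.mdifferentiableAt (by simp))
  exact h2

end AlmostContactMetric

end Endomorphism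

/-! ### Horizontal and vertical projections -/

section Projection

variable {E : Type*} [NormedAddCommGroup E] [NormedSpace ℝ E] [FiniteDimensional ℝ E]
  {M : Type*} [TopologicalSpace M] [ChartedSpace E M] [IsManifold 𝓘(ℝ, E) ∞ M]
  {F : Type*} [NormedAddCommGroup F] [NormedSpace ℝ F] [FiniteDimensional ℝ F]
  {N : Type*} [TopologicalSpace N] [ChartedSpace F N] [IsManifold 𝓘(ℝ, F) ∞ N]

/-- The expression of a map between manifolds in the charts at `x₀` and at its image. -/
def mapRep (x₀ : M) (pr : M → N) : E → F :=
  extChartAt 𝓘(ℝ, F) (pr x₀) ∘ pr ∘ (extChartAt 𝓘(ℝ, E) x₀).symm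

/-- The open set on which `mapRep x₀ pr` represents the map `pr`. -/
def mapRepDomain (x₀ : M) (pr : M → N) : Set E :=
  (extChartAt 𝓘(ℝ, E) x₀).target ∩
    (extChartAt 𝓘(ℝ, E) x₀).symm ⁻¹' (pr ⁻¹' (extChartAt 𝓘(ℝ, F) (pr x₀)).source)

lemma isOpen_mapRepDomain (x₀ : M) {pr : M → N} (hpr : ContMDiff 𝓘(ℝ, E) 𝓘(ℝ, F) ∞ pr) :
    IsOpen (mapRepDomain (E := E) (F := F) x₀ pr) :=
  (continuousOn_extChartAt_symm x₀).isOpen_inter_preimage (isOpen_extChartAt_target x₀)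
    ((isOpen_extChartAt_source (pr x₀)).preimage hpr.continuous)

lemma mem_mapRepDomain (x₀ : M) (pr : M → N) :
    extChartAt 𝓘(ℝ, E) x₀ x₀ ∈ mapRepDomain (E := E) (F := F) x₀ pr := by
  refine ⟨mem_extChartAt_target x₀, ?_⟩
  rw [mem_preimage, mem_preimage, extChartAt_to_inv]
  exact mem_extChartAt_source _

lemma contDiffOn_mapRep (x₀ : M) {pr : M → N} (hpr : ContMDiff 𝓘(ℝ, E) 𝓘(ℝ, F) ∞ pr) :
    ContDiffOn ℝ ∞ (mapRep (E := E) (F := F) x₀ pr) (mapRepDomain (E := E) (F := F) x₀ pr) := by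
  rw [← contMDiffOn_iff_contDiffOn]
  have hψ : ContMDiffOn 𝓘(ℝ, F) 𝓘(ℝ, F) ∞ (extChartAt 𝓘(ℝ, F) (pr x₀))
      (extChartAt 𝓘(ℝ, F) (pr x₀)).source :=
    fun z hz ↦ (contMDiffAt_chart hz).contMDiffWithinAt
  exact hψ.comp
    (hpr.contMDiffOn.comp ((contMDiffOn_extChartAt_symm x₀).mono inter_subset_left)
      (t := univ) fun _ _ ↦ mem_univ _) fun u hu ↦ hu.2

/-- The differential of a map in coordinates. -/
lemma coordL_mfderiv {x₀ y : M} {pr : M → N} (hpr : ContMDiff 𝓘(ℝ, E) 𝓘(ℝ, F) ∞ pr)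
    (hy : y ∈ (extChartAt 𝓘(ℝ, E) x₀).source)
    (hpy : pr y ∈ (extChartAt 𝓘(ℝ, F) (pr x₀)).source) (v : TangentSpace 𝓘(ℝ, E) y) :
    coordL (pr x₀) (pr y) (mfderiv 𝓘(ℝ, E) 𝓘(ℝ, F) pr y v) =
      fderiv ℝ (mapRep (E := E) (F := F) x₀ pr) (extChartAt 𝓘(ℝ, E) x₀ y) (coordL x₀ y v) := by
  have hu : extChartAt 𝓘(ℝ, E) x₀ y ∈ mapRepDomain (E := E) (F := F) x₀ pr := by
    refine ⟨(extChartAt 𝓘(ℝ, E) x₀).map_source hy, ?_⟩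
    rwa [mem_preimage, mem_preimage, (extChartAt 𝓘(ℝ, E) x₀).left_inv hy]
  have hd : DifferentiableAt ℝ (mapRep (E := E) (F := F) x₀ pr) (extChartAt 𝓘(ℝ, E) x₀ y) :=
    ((contDiffOn_mapRep x₀ hpr).contDiffAt
      ((isOpen_mapRepDomain x₀ hpr).mem_nhds hu)).differentiableAt (by simp)
  have e : mapRep (E := E) (F := F) x₀ pr ∘ extChartAt 𝓘(ℝ, E) x₀
      =ᶠ[𝓝 y] extChartAt 𝓘(ℝ, F) (pr x₀) ∘ pr := by
    filter_upwards [(isOpen_extChartAt_source x₀).mem_nhds hy] with z hz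
    exact congrArg (fun z ↦ extChartAt 𝓘(ℝ, F) (pr x₀) (pr z))
      ((extChartAt 𝓘(ℝ, E) x₀).left_inv hz)
  have h := e.mfderiv_eq (I := 𝓘(ℝ, E)) (I' := 𝓘(ℝ, F))
  rw [mfderiv_comp y hd.mdifferentiableAt ((contMDiffAt_chart hy).mdifferentiableAt (by simp)),
    mfderiv_comp y ((contMDiffAt_chart hpy).mdifferentiableAt (by simp))
      (hpr.mdifferentiable (by simp) y), ← coordL_eq_mfderiv hy, ← coordL_eq_mfderiv hpy,
    mfderiv_eq_fderiv] at h
  exact (congrArg (fun L ↦ L v) h).symm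

variable [RiemannianBundle (fun x : M ↦ TangentSpace 𝓘(ℝ, E) x)]
  {pr : M → N}

lemma vPart_add_hPart (x : M) (v : TangentSpace 𝓘(ℝ, E) x) :
    vPart F pr x v + hPart F pr x v = v :=
  Submodule.starProjection_add_starProjection_orthogonal (K := vertical E F pr x) v

lemma vPart_mem (x : M) (v : TangentSpace 𝓘(ℝ, E) x) : vPart F pr x v ∈ vertical E F pr x :=
  Submodule.starProjection_apply_mem _ _

lemma hPart_mem (x : M) (v : TangentSpace 𝓘(ℝ, E) x) : hPart F pr x v ∈ horizontal E F pr x :=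
  Submodule.starProjection_apply_mem _ _

lemma inner_vertical_horizontal {x : M} {v w : TangentSpace 𝓘(ℝ, E) x}
    (hv : v ∈ vertical E F pr x) (hw : w ∈ horizontal E F pr x) : (inner ℝ v w : ℝ) = 0 :=
  Submodule.inner_right_of_mem_orthogonal hv hw

lemma inner_horizontal_vertical {x : M} {v w : TangentSpace 𝓘(ℝ, E) x}
    (hv : v ∈ horizontal E F pr x) (hw : w ∈ vertical E F pr x) : (inner ℝ v w : ℝ) = 0 :=
  Submodule.inner_left_of_mem_orthogonal hw hv

lemma vPart_eq_self {x : M} {v : TangentSpace 𝓘(ℝ, E) x} (hv : v ∈ vertical E F pr x) :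
    vPart F pr x v = v :=
  Submodule.starProjection_eq_self_iff.2 hv

lemma hPart_eq_self {x : M} {v : TangentSpace 𝓘(ℝ, E) x} (hv : v ∈ horizontal E F pr x) :
    hPart F pr x v = v :=
  Submodule.starProjection_eq_self_iff.2 hv

lemma mfderiv_hPart (x : M) (v : TangentSpace 𝓘(ℝ, E) x) :
    mfderiv 𝓘(ℝ, E) 𝓘(ℝ, F) pr x (hPart F pr x v) = mfderiv 𝓘(ℝ, E) 𝓘(ℝ, F) pr x v := by
  have h : mfderiv 𝓘(ℝ, E) 𝓘(ℝ, F) pr x (vPart F pr x v) = 0 := vPart_mem x v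
  conv_rhs => rw [← vPart_add_hPart (F := F) (pr := pr) x v, map_add, h, zero_add]

variable [RiemannianBundle (fun y : N ↦ TangentSpace 𝓘(ℝ, F) y)]

/-- On the horizontal parts, the metric of the total space is pulled back from the base. -/
lemma IsRiemannianSubmersion.inner_hPart (h : IsRiemannianSubmersion E F pr) (x : M)
    (v w : TangentSpace 𝓘(ℝ, E) x) : (inner ℝ (hPart F pr x v) w : ℝ) =
      inner ℝ (mfderiv 𝓘(ℝ, E) 𝓘(ℝ, F) pr x v) (mfderiv 𝓘(ℝ, E) 𝓘(ℝ, F) pr x w) := by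
  rw [← mfderiv_hPart x v, ← mfderiv_hPart x w,
    h.inner_mfderiv x _ (hPart_mem x v) _ (hPart_mem x w)]
  conv_lhs => rw [← vPart_add_hPart (F := F) (pr := pr) x w, inner_add_right,
    inner_horizontal_vertical (hPart_mem x v) (vPart_mem x w), zero_add]

/-- The metric of the base, pulled back to the total space, in coordinates. -/
def pullbackRep (x₀ : M) (pr : M → N) (u : E) : E →L[ℝ] E →L[ℝ] ℝ :=
  (metricRep (E := F) (pr x₀) (mapRep x₀ pr u)).bilinearComp (fderiv ℝ (mapRep x₀ pr) u)
    (fderiv ℝ (mapRep x₀ pr) u)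

lemma IsRiemannianSubmersion.metricRep_endRep_hPart (h : IsRiemannianSubmersion E F pr) {x₀ : M}
    {u : E} (hu : u ∈ mapRepDomain (E := E) (F := F) x₀ pr) (a b : E) :
    metricRep x₀ u (endRep x₀ (fun x ↦ (horizontal E F pr x).starProjection) u a) b
      = pullbackRep (F := F) x₀ pr u a b := by
  have hy := (extChartAt 𝓘(ℝ, E) x₀).map_target hu.1
  have h1 := h.inner_hPart _ (frameL x₀ ((extChartAt 𝓘(ℝ, E) x₀).symm u) a)
    (frameL x₀ ((extChartAt 𝓘(ℝ, E) x₀).symm u) b)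
  rw [inner_eq_metricRep hy, inner_eq_metricRep (x₀ := pr x₀) hu.2, coordL_mfderiv h.contMDiff hy
    hu.2, coordL_mfderiv h.contMDiff hy hu.2, (extChartAt 𝓘(ℝ, E) x₀).right_inv hu.1,
    coordL_frameL hy, coordL_frameL hy] at h1
  exact h1

variable [IsContMDiffRiemannianBundle 𝓘(ℝ, E) ∞ E (fun x : M ↦ TangentSpace 𝓘(ℝ, E) x)]
  [IsContMDiffRiemannianBundle 𝓘(ℝ, F) ∞ F (fun y : N ↦ TangentSpace 𝓘(ℝ, F) y)]

lemma contDiffOn_pullbackRep (x₀ : M) (hpr : ContMDiff 𝓘(ℝ, E) 𝓘(ℝ, F) ∞ pr) :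
    ContDiffOn ℝ ∞ (pullbackRep (E := E) (F := F) x₀ pr)
      (mapRepDomain (E := E) (F := F) x₀ pr) := by
  have hm := contDiffOn_mapRep (E := E) (F := F) x₀ hpr
  have hd := hm.fderiv_of_isOpen (m := ∞) (isOpen_mapRepDomain x₀ hpr) (by simp)
  have hG : ContDiffOn ℝ ∞ (fun u ↦ metricRep (E := F) (pr x₀) (mapRep x₀ pr u))
      (mapRepDomain (E := E) (F := F) x₀ pr) :=
    (contDiffOn_metricRep (E := F) (pr x₀)).comp hm fun u hu ↦
      (extChartAt 𝓘(ℝ, F) (pr x₀)).map_source hu.2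
  rw [contDiffOn_clm_apply]
  intro a
  rw [contDiffOn_clm_apply]
  intro b
  exact (hG.clm_apply (hd.clm_apply contDiffOn_const)).clm_apply (hd.clm_apply contDiffOn_const)

set_option synthInstance.maxHeartbeats 100000 in
/-- The horizontal projection is `g⁻¹` composed with the pulled back metric of the base, hence
differentiable. -/
lemma IsRiemannianSubmersion.diffEndAt_horizontal (h : IsRiemannianSubmersion E F pr) (x : M) :
    DiffEndAt (fun x ↦ (horizontal E F pr x).starProjection) x := by
  have hO := (isOpen_mapRepDomain x h.contMDiff).mem_nhds (mem_mapRepDomain x pr)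
  have hp : DifferentiableAt ℝ (pullbackRep (E := E) (F := F) x pr) (extChartAt 𝓘(ℝ, E) x x) :=
    ((contDiffOn_pullbackRep x h.contMDiff).contDiffAt hO).differentiableAt (by simp)
  have hx : extChartAt 𝓘(ℝ, E) x x ∈ (extChartAt 𝓘(ℝ, E) x).target := mem_extChartAt_target x
  have hi : DifferentiableAt ℝ (fun u ↦ (metricRep x u).inverse) (extChartAt 𝓘(ℝ, E) x x) := by
    obtain ⟨e, he⟩ := isInvertible_metricRep hx
    have h := (contDiffAt_map_inverse (𝕜 := ℝ) (n := 1) e).differentiableAt one_ne_zero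
    rw [he] at h
    exact h.comp _ (hasFDerivAt_metricRep hx).differentiableAt
  refine (hi.clm_comp hp).congr_of_eventuallyEq ?_
  filter_upwards [hO] with u hu
  ext a
  refine metricRep_ext hu.1 fun c ↦ ?_
  rw [h.metricRep_endRep_hPart hu, ContinuousLinearMap.comp_apply,
    (isInvertible_metricRep hu.1).self_apply_inverse]

lemma IsRiemannianSubmersion.diffEndAt_vertical (h : IsRiemannianSubmersion E F pr) (x : M) :
    DiffEndAt (fun x ↦ (vertical E F pr x).starProjection) x := by
  refine ((differentiableAt_const (ContinuousLinearMap.id ℝ E)).sub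
    (h.diffEndAt_horizontal x)).congr_of_eventuallyEq ?_
  filter_upwards [target_mem_nhds (mem_extChartAt_source x)] with u hu
  ext a
  have hy := (extChartAt 𝓘(ℝ, E) x).map_target hu
  have h1 := congrArg (coordL x ((extChartAt 𝓘(ℝ, E) x).symm u)) (vPart_add_hPart (F := F)
    (pr := pr) ((extChartAt 𝓘(ℝ, E) x).symm u) (frameL x ((extChartAt 𝓘(ℝ, E) x).symm u) a))
  rw [map_add, coordL_frameL hy] at h1
  exact eq_sub_of_add_eq h1

end Projection

/-! ### Geodesics -/

section Geodesic

variable {E : Type*} [NormedAddCommGroup E] [NormedSpace ℝ E] [FiniteDimensional ℝ E]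
  {M : Type*} [TopologicalSpace M] [ChartedSpace E M] [IsManifold 𝓘(ℝ, E) ∞ M]

/-- The velocity of a `C²` curve is differentiable. -/
lemma diffAlong_velocity {α : ℝ → M} {s : Set ℝ} (hs : IsOpen s)
    (hα : ContMDiffOn 𝓘(ℝ, ℝ) 𝓘(ℝ, E) 2 α s) {t : ℝ} (ht : t ∈ s) :
    DiffAlong (E := E) α (velocity α) t := by
  have h₀ : α t ∈ (extChartAt 𝓘(ℝ, E) (α t)).source := mem_extChartAt_source _
  have hαt : ContMDiffAt 𝓘(ℝ, ℝ) 𝓘(ℝ, E) 2 α t := hα.contMDiffAt (hs.mem_nhds ht)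
  have h1 : ContDiffAt ℝ 2 (extChartAt 𝓘(ℝ, E) (α t) ∘ α) t := by
    rw [← contMDiffAt_iff_contDiffAt]
    exact ((contMDiffAt_chart h₀).of_le (WithTop.coe_le_coe.2 le_top)).comp t hαt
  have h2 : DifferentiableAt ℝ (deriv (extChartAt 𝓘(ℝ, E) (α t) ∘ α)) t := by
    have := (h1.fderiv_right (m := 1) (by norm_num)).differentiableAt one_ne_zero
    exact this.clm_apply (differentiableAt_const (1 : ℝ))
  refine h2.congr_of_eventuallyEq ?_
  filter_upwards [eventually_mem_source hαt.continuousAt h₀, hs.mem_nhds ht] with r hr hrs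
  exact (hasDerivAt_chart_comp ((hα.contMDiffAt (hs.mem_nhds hrs)).mdifferentiableAt
    two_ne_zero) hr).deriv.symm

/-- A solution of an autonomous `C¹` differential equation is `C²`. -/
lemma contDiffOn_two_of_hasDerivAt {G : Type*} [NormedAddCommGroup G] [NormedSpace ℝ G]
    {Φ : G → G} {O : Set G} (hΦ : ContDiffOn ℝ 1 Φ O) {γ : ℝ → G} {s : Set ℝ} (hs : IsOpen s)
    (hγO : MapsTo γ s O) (hγ : ∀ t ∈ s, HasDerivAt γ (Φ (γ t)) t) : ContDiffOn ℝ 2 γ s := by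
  have hd : DifferentiableOn ℝ γ s := fun t ht ↦ (hγ t ht).differentiableAt.differentiableWithinAt
  have hder : ∀ t ∈ s, deriv γ t = (Φ ∘ γ) t := fun t ht ↦ (hγ t ht).deriv
  have h1 : ContDiffOn ℝ 1 γ s := by
    rw [show (1 : WithTop ℕ∞) = 0 + 1 by norm_num, contDiffOn_succ_iff_deriv_of_isOpen hs]
    refine ⟨hd, by simp, contDiffOn_zero.2 ?_⟩
    exact (hΦ.continuousOn.comp hd.continuousOn hγO).congr hder
  rw [show (2 : WithTop ℕ∞) = 1 + 1 by norm_num, contDiffOn_succ_iff_deriv_of_isOpen hs]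
  exact ⟨hd, by simp, (hΦ.comp h1 hγO).congr hder⟩

variable [RiemannianBundle (fun x : M ↦ TangentSpace 𝓘(ℝ, E) x)]
  [IsContMDiffRiemannianBundle 𝓘(ℝ, E) ∞ E (fun x : M ↦ TangentSpace 𝓘(ℝ, E) x)]

lemma IsGeodesicOn.mdifferentiableAt {α : ℝ → M} {s : Set ℝ} (h : IsGeodesicOn (E := E) α s)
    {t : ℝ} (ht : t ∈ s) : MDifferentiableAt 𝓘(ℝ, ℝ) 𝓘(ℝ, E) α t :=
  (h.contMDiffOn.contMDiffAt (h.isOpen.mem_nhds ht)).mdifferentiableAt two_ne_zero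

lemma IsGeodesicOn.diffAlong {α : ℝ → M} {s : Set ℝ} (h : IsGeodesicOn (E := E) α s)
    {t : ℝ} (ht : t ∈ s) : DiffAlong (E := E) α (velocity α) t :=
  diffAlong_velocity h.isOpen h.contMDiffOn ht

/-- Every tangent vector is the initial velocity of a geodesic. As `α 0 = x` is not definitional,
the velocity and `v` are compared by their coordinates in the chart at `x`. -/
lemma exists_geodesic (x : M) (v : TangentSpace 𝓘(ℝ, E) x) :
    ∃ (α : ℝ → M) (s : Set ℝ), IsGeodesicOn (E := E) α s ∧ (0 : ℝ) ∈ s ∧ α 0 = x ∧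
      coordL x (α 0) (velocity α 0) = coordL x x v := by
  have hx : x ∈ (extChartAt 𝓘(ℝ, E) x).source := mem_extChartAt_source x
  -- the geodesic equation in the chart at `x`, as a first order equation
  set Φ : E × E → E × E := fun p ↦ (p.2, -christoffel (metricRep x) p.1 p.2 p.2) with hΦ
  set O : Set (E × E) := (extChartAt 𝓘(ℝ, E) x).target ×ˢ univ with hO
  have hOo : IsOpen O := (isOpen_extChartAt_target x).prod isOpen_univ
  have hΦd (p : E × E) (hp : p ∈ O) : ContDiffAt ℝ 1 Φ p :=
    contDiffAt_snd.prodMk (contDiffAt_christoffel (isInvertible_metricRep hp.1)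
      ((contDiffAt_metricRep hp.1).of_le (WithTop.coe_le_coe.2 le_top))).neg
  have hp₀ : (extChartAt 𝓘(ℝ, E) x x, coordL x x v) ∈ O := ⟨mem_extChartAt_target x, mem_univ _⟩
  obtain ⟨γ, hγ0, ε, hε, hγ⟩ :=
    (hΦd _ hp₀).exists_forall_mem_closedBall_exists_eq_forall_mem_Ioo_hasDerivAt₀ 0
  have h00 : (0 : ℝ) ∈ Ioo (0 - ε) (0 + ε) := by constructor <;> linarith
  have hev : ∀ᶠ t in 𝓝 (0 : ℝ), γ t ∈ O ∧ t ∈ Ioo (0 - ε) (0 + ε) := by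
    refine ((hγ 0 h00).continuousAt.eventually (hOo.mem_nhds ?_)).and (isOpen_Ioo.mem_nhds h00)
    rwa [hγ0]
  obtain ⟨δ, hδ, hball⟩ := Metric.eventually_nhds_iff_ball.1 hev
  set s : Set ℝ := Metric.ball (0 : ℝ) δ with hs
  have hso : IsOpen s := Metric.isOpen_ball
  set α : ℝ → M := fun t ↦ (extChartAt 𝓘(ℝ, E) x).symm (γ t).1 with hα
  have hγ' (t : ℝ) (ht : t ∈ s) : HasDerivAt γ (Φ (γ t)) t := hγ t (hball t ht).2
  have hc (t : ℝ) (ht : t ∈ s) : HasDerivAt (fun t ↦ (γ t).1) (γ t).2 t := (hγ' t ht).fst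
  have hw (t : ℝ) (ht : t ∈ s) : HasDerivAt (fun t ↦ (γ t).2)
    (-christoffel (metricRep x) (γ t).1 (γ t).2 (γ t).2) t := (hγ' t ht).snd
  have hsource (t : ℝ) (ht : t ∈ s) : α t ∈ (extChartAt 𝓘(ℝ, E) x).source :=
    (extChartAt 𝓘(ℝ, E) x).map_target (hball t ht).1.1
  have hφα (t : ℝ) (ht : t ∈ s) : extChartAt 𝓘(ℝ, E) x (α t) = (γ t).1 :=
    (extChartAt 𝓘(ℝ, E) x).right_inv (hball t ht).1.1
  have hαC : ContMDiffOn 𝓘(ℝ, ℝ) 𝓘(ℝ, E) 2 α s := by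
    have h1 : ContDiffOn ℝ 2 γ s := contDiffOn_two_of_hasDerivAt
      (fun p hp ↦ (hΦd p hp).contDiffWithinAt) hso (fun t ht ↦ (hball t ht).1) hγ'
    have h2 : ContDiffOn ℝ 2 (fun t ↦ (γ t).1) s := contDiff_fst.comp_contDiffOn h1
    exact (contMDiffOn_extChartAt_symm x).comp (contMDiffOn_iff_contDiffOn.2 h2)
      fun t ht ↦ (hball t ht).1.1
  have hαd (t : ℝ) (ht : t ∈ s) : MDifferentiableAt 𝓘(ℝ, ℝ) 𝓘(ℝ, E) α t :=
    (hαC.contMDiffAt (hso.mem_nhds ht)).mdifferentiableAt two_ne_zero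
  have hvel (t : ℝ) (ht : t ∈ s) : alongRep x α (velocity α) t = (γ t).2 := by
    have h1 := hasDerivAt_chart_comp (hαd t ht) (hsource t ht)
    refine h1.unique ((hc t ht).congr_of_eventuallyEq ?_)
    filter_upwards [hso.mem_nhds ht] with r hr using hφα r hr
  have h0s : (0 : ℝ) ∈ s := Metric.mem_ball_self hδ
  refine ⟨α, s, ⟨hso, (convex_ball 0 δ).ordConnected, hαC, fun t ht ↦ ?_⟩, h0s, ?_, ?_⟩
  · have e : alongRep x α (velocity α) =ᶠ[𝓝 t] fun t ↦ (γ t).2 := by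
      filter_upwards [hso.mem_nhds ht] with r hr using hvel r hr
    have hd := (hw t ht).congr_of_eventuallyEq e
    refine coordL_injective (hsource t ht) ?_
    rw [coordL_covDerivAlong (hαd t ht) (hsource t ht) hd.differentiableAt, hd.deriv, map_zero,
      hφα t ht, show coordL x (α t) (velocity α t) = (γ t).2 from hvel t ht, hvel t ht,
      neg_add_cancel]
  · rw [hα]
    simp only [hγ0]
    exact extChartAt_to_inv x
  · exact (hvel 0 h0s).trans (by rw [hγ0])

/-- Geodesics have constant speed. -/
lemma IsGeodesicOn.hasDerivAt_speed {α : ℝ → M} {s : Set ℝ} (h : IsGeodesicOn (E := E) α s)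
    {t : ℝ} (ht : t ∈ s) :
    HasDerivAt (fun r ↦ (inner ℝ (velocity (E := E) α r) (velocity α r) : ℝ)) 0 t := by
  have h1 := hasDerivAt_inner_along (h.mdifferentiableAt ht) (h.diffAlong ht) (h.diffAlong ht)
  rwa [h.covDeriv_velocity t ht, inner_zero_left, inner_zero_right, add_zero] at h1

/-- A function with vanishing derivative on the interval of a geodesic is constant there. -/
lemma IsGeodesicOn.eq_of_hasDerivAt_zero {α : ℝ → M} {s : Set ℝ} (h : IsGeodesicOn (E := E) α s)
    {k : ℝ → ℝ} (hk : ∀ t ∈ s, HasDerivAt k 0 t) {t₁ t₂ : ℝ} (h₁ : t₁ ∈ s) (h₂ : t₂ ∈ s) :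
    k t₁ = k t₂ :=
  h.isOpen.is_const_of_deriv_eq_zero h.ordConnected.isPreconnected
    (fun t ht ↦ (hk t ht).differentiableAt.differentiableWithinAt) (fun t ht ↦ (hk t ht).deriv)
    h₁ h₂

lemma IsGeodesicOn.norm_velocity_eq {α : ℝ → M} {s : Set ℝ} (h : IsGeodesicOn (E := E) α s)
    {t₁ t₂ : ℝ} (h₁ : t₁ ∈ s) (h₂ : t₂ ∈ s) :
    ‖velocity (E := E) α t₁‖ = ‖velocity (E := E) α t₂‖ := by
  have h3 := h.eq_of_hasDerivAt_zero (fun t ht ↦ h.hasDerivAt_speed ht) h₁ h₂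
  simp only [real_inner_self_eq_norm_sq] at h3
  exact (sq_eq_sq₀ (norm_nonneg _) (norm_nonneg _)).1 h3

/-- The chain rule for a function along a curve. -/
lemma hasDerivAt_comp_curve {f : M → ℝ} {α : ℝ → M} {t : ℝ}
    (hf : MDifferentiableAt 𝓘(ℝ, E) 𝓘(ℝ, ℝ) f (α t))
    (hα : MDifferentiableAt 𝓘(ℝ, ℝ) 𝓘(ℝ, E) α t) :
    HasDerivAt (fun s ↦ f (α s)) (inner ℝ (grad (E := E) f (α t)) (velocity (E := E) α t)) t := by
  have h₀ : α t ∈ (extChartAt 𝓘(ℝ, E) (α t)).source := mem_extChartAt_source _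
  have hf' := (mdifferentiableAt_iff_comp_symm h₀ f).1 hf
  rw [inner_grad, dirDeriv_eq h₀ hf']
  refine (hf'.hasFDerivAt.comp_hasDerivAt t (hasDerivAt_chart_comp hα h₀)).congr_of_eventuallyEq ?_
  filter_upwards [eventually_mem_source hα.continuousAt h₀] with s hs
  exact (congrArg f ((extChartAt 𝓘(ℝ, E) (α t)).left_inv hs)).symm

end Geodesic

/-! ### Vertical fields on a Riemannian submersion -/

section Vertical

variable {E : Type*} [NormedAddCommGroup E] [NormedSpace ℝ E] [FiniteDimensional ℝ E]
  {M : Type*} [TopologicalSpace M] [ChartedSpace E M] [IsManifold 𝓘(ℝ, E) ∞ M]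
  {F : Type*} [NormedAddCommGroup F] [NormedSpace ℝ F] [FiniteDimensional ℝ F]
  {N : Type*} [TopologicalSpace N] [ChartedSpace F N] [IsManifold 𝓘(ℝ, F) ∞ N]
  [RiemannianBundle (fun x : M ↦ TangentSpace 𝓘(ℝ, E) x)]
  [IsContMDiffRiemannianBundle 𝓘(ℝ, E) ∞ E (fun x : M ↦ TangentSpace 𝓘(ℝ, E) x)]
  [RiemannianBundle (fun y : N ↦ TangentSpace 𝓘(ℝ, F) y)]
  [IsContMDiffRiemannianBundle 𝓘(ℝ, F) ∞ F (fun y : N ↦ TangentSpace 𝓘(ℝ, F) y)]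
  {pr : M → N}

/-- In the chart at `x`, the pulled back metric of the base is at most the metric of the total
space. -/
lemma IsRiemannianSubmersion.pullbackRep_le (h : IsRiemannianSubmersion E F pr) {x : M}
    {u : E} (hu : u ∈ mapRepDomain (E := E) (F := F) x pr) (a : E) :
    pullbackRep (F := F) x pr u a a ≤ metricRep x u a a := by
  have hy := (extChartAt 𝓘(ℝ, E) x).map_target hu.1
  rw [← h.metricRep_endRep_hPart hu]
  set w := frameL (E := E) x ((extChartAt 𝓘(ℝ, E) x).symm u) a
  have e : endRep x (fun x ↦ (horizontal E F pr x).starProjection) u a =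
    coordL x ((extChartAt 𝓘(ℝ, E) x).symm u) (hPart F pr _ w) := rfl
  rw [e, metricRep_apply, metricRep_apply, frameL_coordL hy]
  conv_lhs => rw [show frameL x ((extChartAt 𝓘(ℝ, E) x).symm u) a = w from rfl]
  have hw := vPart_add_hPart (F := F) (pr := pr) _ w
  have h1 : (inner ℝ w w : ℝ) = inner ℝ (vPart F pr _ w) (vPart F pr _ w)
      + inner ℝ (hPart F pr _ w) w := by
    conv_lhs => rw [← hw]
    rw [inner_add_left, inner_add_right, inner_add_right,
      inner_vertical_horizontal (vPart_mem _ w) (hPart_mem _ w), add_zero, ← inner_add_right, hw]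
  rw [show (inner ℝ (frameL x ((extChartAt 𝓘(ℝ, E) x).symm u) a)
    (frameL x ((extChartAt 𝓘(ℝ, E) x).symm u) a) : ℝ) = inner ℝ w w from rfl, h1]
  linarith [real_inner_self_nonneg (x := vPart F pr _ w)]

/-- At the base point, the metric and the pulled back metric of the base agree on pairs with a
horizontal entry. -/
lemma IsRiemannianSubmersion.pullbackRep_eq (h : IsRiemannianSubmersion E F pr) {x : M}
    {v : TangentSpace 𝓘(ℝ, E) x} (hv : v ∈ horizontal E F pr x) (c : E) :
    pullbackRep (F := F) x pr (extChartAt 𝓘(ℝ, E) x x) c (coordL x x v)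
      = metricRep x (extChartAt 𝓘(ℝ, E) x x) c (coordL x x v) := by
  have hx : x ∈ (extChartAt 𝓘(ℝ, E) x).source := mem_extChartAt_source x
  obtain ⟨w, rfl⟩ : ∃ w : TangentSpace 𝓘(ℝ, E) x, coordL x x w = c :=
    ⟨frameL x x c, coordL_frameL hx c⟩
  rw [← h.metricRep_endRep_hPart (mem_mapRepDomain x pr), ← inner_eq_metricRep hx,
    ← coordL_end_apply hx w, ← inner_eq_metricRep hx]
  conv_rhs => rw [← vPart_add_hPart (F := F) (pr := pr) x w, inner_add_left,
    inner_vertical_horizontal (vPart_mem x w) hv, zero_add]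
  rfl

/-- For a vertical field `ξ` and a horizontal vector `v`, `g(∇_v ξ, v) = 0`: the metric on
horizontal vectors is pulled back from the base, hence constant along `ξ`. -/
lemma IsRiemannianSubmersion.inner_nabla_vertical (h : IsRiemannianSubmersion E F pr) {x : M}
    {ξ : ∀ x : M, TangentSpace 𝓘(ℝ, E) x} (hξ : ∀ x, ξ x ∈ vertical E F pr x)
    (hξd : DifferentiableAt ℝ (fieldRep x ξ) (extChartAt 𝓘(ℝ, E) x x))
    {v : TangentSpace 𝓘(ℝ, E) x} (hv : v ∈ horizontal E F pr x) :
    (inner ℝ (nabla ξ x v) v : ℝ) = 0 := by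
  have hx : x ∈ (extChartAt 𝓘(ℝ, E) x).source := mem_extChartAt_source x
  set u₀ := extChartAt 𝓘(ℝ, E) x x with hu₀
  have hut : u₀ ∈ (extChartAt 𝓘(ℝ, E) x).target := mem_extChartAt_target x
  set a := coordL x x v with ha
  set b := coordL x x (ξ x) with hb
  set p : E → F := mapRep x pr with hp
  have hum := mem_mapRepDomain (E := E) (F := F) x pr
  have hOn : mapRepDomain (E := E) (F := F) x pr ∈ 𝓝 u₀ :=
    (isOpen_mapRepDomain x h.contMDiff).mem_nhds hum
  have hpC : ContDiffAt ℝ ∞ p u₀ := (contDiffOn_mapRep x h.contMDiff).contDiffAt hOn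
  have hp1 : HasFDerivAt p (fderiv ℝ p u₀) u₀ :=
    (hpC.differentiableAt (by simp)).hasFDerivAt
  have hp2 : HasFDerivAt (fderiv ℝ p) (fderiv ℝ (fderiv ℝ p) u₀) u₀ :=
    ((hpC.fderiv_right (m := 1) (WithTop.coe_le_coe.2 le_top)).differentiableAt
      one_ne_zero).hasFDerivAt
  -- `ξ` is vertical: its coordinate expression is killed by the differential of `p`
  have hker : (fun u ↦ fderiv ℝ p u (fieldRep x ξ u)) =ᶠ[𝓝 u₀] fun _ ↦ 0 := by
    filter_upwards [hOn] with u hu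
    have hy := (extChartAt 𝓘(ℝ, E) x).map_target hu.1
    have h1 := coordL_mfderiv (x₀ := x) h.contMDiff hy hu.2 (ξ ((extChartAt 𝓘(ℝ, E) x).symm u))
    have h2 : mfderiv 𝓘(ℝ, E) 𝓘(ℝ, F) pr ((extChartAt 𝓘(ℝ, E) x).symm u)
      (ξ ((extChartAt 𝓘(ℝ, E) x).symm u)) = 0 := hξ _
    rw [h2, map_zero, (extChartAt 𝓘(ℝ, E) x).right_inv hu.1] at h1
    exact h1.symm
  have hpb : fderiv ℝ p u₀ b = 0 := by
    rw [hb, ← fieldRep_apply hx ξ]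
    exact hker.self_of_nhds
  have hsecond : fderiv ℝ (fderiv ℝ p) u₀ b a = -fderiv ℝ p u₀ (fderiv ℝ (fieldRep x ξ) u₀ a) := by
    have h1 := (hp2.clm_apply hξd.hasFDerivAt).unique
      ((hasFDerivAt_const (0 : F) u₀).congr_of_eventuallyEq hker)
    have h2 := congrArg (fun L ↦ L a) h1
    simp only [add_apply, ContinuousLinearMap.comp_apply, ContinuousLinearMap.flip_apply,
      zero_apply] at h2
    have hsymm : IsSymmSndFDerivAt ℝ p u₀ := hpC.isSymmSndFDerivAt (by
      rw [minSmoothness_of_isRCLikeNormedField]; exact WithTop.coe_le_coe.2 le_top)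
    rw [hsymm b a, eq_neg_iff_add_eq_zero, add_comm, hb, ← fieldRep_apply hx ξ]
    exact h2
  -- the derivatives of the two metrics at `a` agree, as their difference has a minimum
  have hpull : HasFDerivAt (fun u ↦ pullbackRep (F := F) x pr u a a)
      (fderiv ℝ (fun u ↦ metricRep x u a a) u₀) u₀ := by
    have hd1 : DifferentiableAt ℝ (fun u ↦ metricRep x u a a) u₀ :=
      ((hasFDerivAt_metricRep hut).differentiableAt.clm_apply
        (differentiableAt_const a)).clm_apply (differentiableAt_const a)
    have hd2 : DifferentiableAt ℝ (fun u ↦ pullbackRep (F := F) x pr u a a) u₀ :=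
      ((((contDiffOn_pullbackRep x h.contMDiff).contDiffAt hOn).differentiableAt
        (by simp)).clm_apply (differentiableAt_const a)).clm_apply (differentiableAt_const a)
    have hmin : IsLocalMin (fun u ↦ metricRep x u a a - pullbackRep (F := F) x pr u a a) u₀ := by
      filter_upwards [hOn] with u hu
      rw [h.pullbackRep_eq hv, sub_self]
      exact sub_nonneg.2 (h.pullbackRep_le hu a)
    have h0 := hmin.hasFDerivAt_eq_zero (hd1.hasFDerivAt.sub hd2.hasFDerivAt)
    rw [sub_eq_zero.1 h0]
    exact hd2.hasFDerivAt
  have hderiv : fderiv ℝ (metricRep x) u₀ b a a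
      = -2 * metricRep x u₀ (fderiv ℝ (fieldRep x ξ) u₀ a) a := by
    have hGN := (hasFDerivAt_metricRep (E := F) (x₀ := pr x) (u := p u₀)
      ((extChartAt 𝓘(ℝ, F) (pr x)).map_source hum.2)).comp u₀ hp1
    have hpa := hp2.clm_apply (hasFDerivAt_const a u₀)
    have h1 := ((hGN.clm_apply hpa).clm_apply hpa).unique hpull
    have h2 := congrArg (fun L ↦ L b) h1
    simp only [add_apply, ContinuousLinearMap.comp_apply, ContinuousLinearMap.flip_apply,
      zero_apply, hpb, map_zero, zero_add, Function.comp, hsecond, map_neg, neg_apply] at h2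
    rw [fderiv_apply_apply (hasFDerivAt_metricRep hut).differentiableAt,
      metricRep_comm (E := F) (pr x)] at h2
    have h3 := h.pullbackRep_eq hv (fderiv ℝ (fieldRep x ξ) u₀ a)
    rw [← h3, ← h2]
    change _ = -2 * metricRep (E := F) (pr x) (p u₀)
      (fderiv ℝ p u₀ (fderiv ℝ (fieldRep x ξ) u₀ a)) (fderiv ℝ p u₀ a)
    ring
  rw [inner_eq_metricRep hx, coordL_nabla hx hξd, map_add, add_apply, metricRep_christoffel hut,
    fderiv_metricRep_comm hut a b a, hderiv]
  ring

end Vertical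

/-! ### Almost contact metric and Kenmotsu structures -/

section Contact

variable {E : Type*} [NormedAddCommGroup E] [NormedSpace ℝ E] [FiniteDimensional ℝ E]
  {M : Type*} [TopologicalSpace M] [ChartedSpace E M] [IsManifold 𝓘(ℝ, E) ∞ M]
  [RiemannianBundle (fun x : M ↦ TangentSpace 𝓘(ℝ, E) x)]

namespace AlmostContactMetric

variable (S : AlmostContactMetric E M)

lemma η_eq_inner (x : M) (v : TangentSpace 𝓘(ℝ, E) x) : S.η x v = inner ℝ v (S.ξ x) := by
  have h := S.inner_φ_φ x v (S.ξ x)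
  rw [S.φ_ξ, inner_zero_right, S.η_ξ, mul_one] at h
  linarith

lemma η_φ (x : M) (v : TangentSpace 𝓘(ℝ, E) x) : S.η x (S.φ x v) = 0 := by
  have h1 := S.φ_φ x (S.φ x v)
  rw [S.φ_φ x v, map_add, map_neg, map_smul, S.φ_ξ, smul_zero, add_zero, left_eq_add] at h1
  have h2 := congrArg (S.η x) h1
  rwa [map_smul, S.η_ξ, smul_eq_mul, mul_one, map_zero] at h2

lemma inner_φ_self (x : M) (v : TangentSpace 𝓘(ℝ, E) x) : (inner ℝ (S.φ x v) v : ℝ) = 0 := by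
  have h := S.inner_φ_φ x v (S.φ x v)
  rw [S.φ_φ, S.η_φ, mul_zero, sub_zero, inner_add_right, inner_neg_right, inner_smul_right,
    ← S.η_eq_inner, S.η_φ, mul_zero, add_zero, real_inner_comm] at h
  linarith [real_inner_comm v (S.φ x v)]

variable [IsContMDiffRiemannianBundle 𝓘(ℝ, E) ∞ E (fun x : M ↦ TangentSpace 𝓘(ℝ, E) x)]

lemma nabla_zero_field (x : M) (v : TangentSpace 𝓘(ℝ, E) x) :
    nabla (fun y : M ↦ (0 : TangentSpace 𝓘(ℝ, E) y)) x v = 0 := by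
  have hx : x ∈ (extChartAt 𝓘(ℝ, E) x).source := mem_extChartAt_source x
  have e : fieldRep x (fun y : M ↦ (0 : TangentSpace 𝓘(ℝ, E) y)) = fun _ ↦ 0 :=
    funext fun u ↦ map_zero _
  refine coordL_injective hx ?_
  have h := christoffel_add_right (mem_extChartAt_target x) (coordL x x v) 0 0
  rw [add_zero, left_eq_add] at h
  rw [coordL_nabla hx (e ▸ differentiableAt_const 0), e, fderiv_const_apply, zero_apply, map_zero,
    h, zero_add]

variable {S}

/-- On vectors orthogonal to `ξ`, a Kenmotsu structure satisfies `g(∇_v ξ, w) = g(v, w)`. -/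
lemma IsKenmotsu.inner_nabla_ξ (hS : S.IsKenmotsu) (x : M) (v : TangentSpace 𝓘(ℝ, E) x)
    {w : TangentSpace 𝓘(ℝ, E) x} (hw : S.η x w = 0) :
    (inner ℝ (nabla S.ξ x v) w : ℝ) = inner ℝ v w := by
  have h1 := hS.nabla_φ S.ξ S.ξ_smooth x v
  rw [← S.η_eq_inner, S.η_φ, zero_smul, S.η_ξ, one_smul, zero_sub] at h1
  simp only [S.φ_ξ] at h1
  rw [nabla_zero_field, zero_sub, neg_inj] at h1
  have h2 := S.inner_φ_φ x (nabla S.ξ x v) w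
  rw [h1, S.inner_φ_φ, hw, mul_zero, mul_zero, sub_zero, sub_zero] at h2
  exact h2.symm

end AlmostContactMetric

variable {S : AlmostContactMetric E M}
  [IsContMDiffRiemannianBundle 𝓘(ℝ, E) ∞ E (fun x : M ↦ TangentSpace 𝓘(ℝ, E) x)]
  {F : Type*} [NormedAddCommGroup F] [NormedSpace ℝ F] [FiniteDimensional ℝ F]
  {N : Type*} [TopologicalSpace N] [ChartedSpace F N] [IsManifold 𝓘(ℝ, F) ∞ N]
  [RiemannianBundle (fun y : N ↦ TangentSpace 𝓘(ℝ, F) y)]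
  [IsContMDiffRiemannianBundle 𝓘(ℝ, F) ∞ F (fun y : N ↦ TangentSpace 𝓘(ℝ, F) y)]
  {pr : M → N}

/-- If the Reeb field of a Kenmotsu manifold is tangent to the fibres of a Riemannian submersion,
there are no horizontal vectors except `0`. -/
lemma AlmostContactMetric.ReebVertical.eq_zero_of_mem_horizontal (hS : S.IsKenmotsu)
    (h : IsRiemannianSubmersion E F pr) (hξ : S.ReebVertical F pr) {x : M}
    {v : TangentSpace 𝓘(ℝ, E) x} (hv : v ∈ horizontal E F pr x) : v = 0 := by
  have h1 := h.inner_nabla_vertical hξ (S.ξ_smooth.differentiableAt_fieldRep x) hv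
  rw [hS.inner_nabla_ξ x v (by
    rw [S.η_eq_inner]; exact inner_horizontal_vertical hv (hξ x)), inner_self_eq_zero] at h1
  exact h1

end Contact

/-! ### The Clairaut condition as a differential identity -/

section Clairaut

variable {E : Type*} [NormedAddCommGroup E] [NormedSpace ℝ E] [FiniteDimensional ℝ E]
  {M : Type*} [TopologicalSpace M] [ChartedSpace E M] [IsManifold 𝓘(ℝ, E) ∞ M]
  {F : Type*} [NormedAddCommGroup F] [NormedSpace ℝ F] [FiniteDimensional ℝ F]
  {N : Type*} [TopologicalSpace N] [ChartedSpace F N] [IsManifold 𝓘(ℝ, F) ∞ N]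
  [RiemannianBundle (fun x : M ↦ TangentSpace 𝓘(ℝ, E) x)]
  {pr : M → N}

lemma norm_sq_eq_vPart_add_hPart (x : M) (v : TangentSpace 𝓘(ℝ, E) x) :
    ‖v‖ ^ 2 = ‖vPart F pr x v‖ ^ 2 + ‖hPart F pr x v‖ ^ 2 := by
  have h := norm_add_sq_eq_norm_sq_add_norm_sq_real
    (inner_vertical_horizontal (vPart_mem (F := F) (pr := pr) x v) (hPart_mem x v))
  rw [vPart_add_hPart] at h
  linarith

lemma norm_mul_sin_angle_hPart {x : M} {v : TangentSpace 𝓘(ℝ, E) x} (hv : v ≠ 0) :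
    ‖v‖ * Real.sin (InnerProductGeometry.angle v (hPart F pr x v)) = ‖vPart F pr x v‖ := by
  have hs : hPart F pr x v + vPart F pr x v = v := by rw [add_comm, vPart_add_hPart]
  have h0 : hPart F pr x v ≠ 0 ∨ vPart F pr x v ≠ 0 := by
    by_contra! h
    rw [h.1, h.2, add_zero] at hs
    exact hv hs.symm
  have h := InnerProductGeometry.sin_angle_add_of_inner_eq_zero
    (inner_horizontal_vertical (hPart_mem (F := F) (pr := pr) x v) (vPart_mem x v)) h0
  rw [hs] at h
  rw [InnerProductGeometry.angle_comm, h, mul_div_cancel₀ _ (norm_ne_zero_iff.2 hv)]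

variable [IsContMDiffRiemannianBundle 𝓘(ℝ, E) ∞ E (fun x : M ↦ TangentSpace 𝓘(ℝ, E) x)]
  [RiemannianBundle (fun y : N ↦ TangentSpace 𝓘(ℝ, F) y)]
  [IsContMDiffRiemannianBundle 𝓘(ℝ, F) ∞ F (fun y : N ↦ TangentSpace 𝓘(ℝ, F) y)]

lemma IsGeodesicOn.diffAlong_vPart {α : ℝ → M} {s : Set ℝ} (hα : IsGeodesicOn (E := E) α s)
    (h : IsRiemannianSubmersion E F pr) {t : ℝ} (ht : t ∈ s) :
    DiffAlong (E := E) α (fun t ↦ vPart F pr (α t) (velocity α t)) t :=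
  (hα.diffAlong ht).end_apply (h.diffEndAt_vertical _) (hα.mdifferentiableAt ht)

lemma IsGeodesicOn.hasDerivAt_norm_vPart_sq {α : ℝ → M} {s : Set ℝ}
    (hα : IsGeodesicOn (E := E) α s) (h : IsRiemannianSubmersion E F pr) {t : ℝ} (ht : t ∈ s) :
    HasDerivAt (fun t ↦ ‖vPart F pr (α t) (velocity (E := E) α t)‖ ^ 2)
      (2 * (inner ℝ (covDerivAlong (E := E) α (fun t ↦ vPart F pr (α t) (velocity α t)) t)
        (vPart F pr (α t) (velocity (E := E) α t)) : ℝ)) t := by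
  have hd := hα.diffAlong_vPart h ht
  have h1 := hasDerivAt_inner_along (hα.mdifferentiableAt ht) hd hd
  rw [real_inner_comm, ← two_mul, real_inner_comm] at h1
  simpa only [real_inner_self_eq_norm_sq] using h1

/-- The derivative of `(e^f ‖V‖)²` along a geodesic, where `V` is the vertical part of the
velocity. -/
lemma IsGeodesicOn.hasDerivAt_exp_mul_norm_vPart {α : ℝ → M} {s : Set ℝ}
    (hα : IsGeodesicOn (E := E) α s) (h : IsRiemannianSubmersion E F pr) {f : M → ℝ}
    (hf : ContMDiff 𝓘(ℝ, E) 𝓘(ℝ, ℝ) ∞ f) {t : ℝ} (ht : t ∈ s) :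
    HasDerivAt (fun t ↦ (Real.exp (f (α t)) * ‖vPart F pr (α t) (velocity (E := E) α t)‖) ^ 2)
      (2 * Real.exp (f (α t)) ^ 2 *
        ((inner ℝ (grad (E := E) f (α t)) (velocity (E := E) α t) : ℝ)
            * ‖vPart F pr (α t) (velocity (E := E) α t)‖ ^ 2
          + (inner ℝ (covDerivAlong (E := E) α (fun t ↦ vPart F pr (α t) (velocity α t)) t)
            (vPart F pr (α t) (velocity (E := E) α t)) : ℝ))) t := by
  have h1 := hasDerivAt_comp_curve (hf.mdifferentiable (by simp) (α t)) (hα.mdifferentiableAt ht)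
  have h2 := (h1.exp.fun_pow 2).fun_mul (hα.hasDerivAt_norm_vPart_sq h ht)
  simp only [mul_pow]
  refine h2.congr_deriv ?_
  push_cast
  ring

/-- The Clairaut condition says that `e^f ‖V‖` is constant along geodesics, which is a differential
identity. -/
lemma isClairautWith_exp_iff (h : IsRiemannianSubmersion E F pr) {f : M → ℝ}
    (hf : ContMDiff 𝓘(ℝ, E) 𝓘(ℝ, ℝ) ∞ f) :
    IsClairautWith E F pr (fun x ↦ Real.exp (f x)) ↔
      ∀ (α : ℝ → M) (s : Set ℝ), IsGeodesicOn (E := E) α s → ∀ t ∈ s,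
        (inner ℝ (grad (E := E) f (α t)) (velocity (E := E) α t) : ℝ)
            * ‖vPart F pr (α t) (velocity (E := E) α t)‖ ^ 2
          + (inner ℝ (covDerivAlong (E := E) α (fun t ↦ vPart F pr (α t) (velocity α t)) t)
            (vPart F pr (α t) (velocity (E := E) α t)) : ℝ) = 0 := by
  constructor
  · intro hC α s hα t ht
    have hd := hα.hasDerivAt_exp_mul_norm_vPart h hf ht
    have hconst : (fun t ↦ (Real.exp (f (α t)) *
        ‖vPart F pr (α t) (velocity (E := E) α t)‖) ^ 2) =ᶠ[𝓝 t] fun _ ↦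
        (Real.exp (f (α t)) * ‖vPart F pr (α t) (velocity (E := E) α t)‖) ^ 2 := by
      filter_upwards [hα.isOpen.mem_nhds ht] with r hr
      have hn := hα.norm_velocity_eq hr ht
      by_cases hv : velocity (E := E) α t = 0
      · have hv' : velocity (E := E) α r = 0 := by rwa [← norm_eq_zero, hn, norm_eq_zero]
        simp [vPart, hv, hv']
      · have hv' : velocity (E := E) α r ≠ 0 := by rwa [← norm_ne_zero_iff, hn, norm_ne_zero_iff]
        rw [← norm_mul_sin_angle_hPart hv, ← norm_mul_sin_angle_hPart hv', hn, mul_left_comm,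
          mul_left_comm (Real.exp (f (α t))), hC.constant α s hα r hr t ht]
    have h0 := hd.unique ((hasDerivAt_const t _).congr_of_eventuallyEq hconst)
    exact (mul_eq_zero.1 h0).resolve_left (by positivity)
  · intro hD
    refine ⟨h, fun x ↦ Real.exp_pos _, fun α s hα t₁ h₁ t₂ h₂ ↦ ?_⟩
    have hn := hα.norm_velocity_eq h₁ h₂
    by_cases hv : velocity (E := E) α t₁ = 0
    · -- a geodesic with vanishing velocity is a point
      have hz (t : ℝ) (ht : t ∈ s) : velocity (E := E) α t = 0 := by
        rw [← norm_eq_zero, hα.norm_velocity_eq ht h₁, hv, norm_zero]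
      have hf0 : f (α t₁) = f (α t₂) := hα.eq_of_hasDerivAt_zero (fun t ht ↦ by
        have h1 := hasDerivAt_comp_curve (hf.mdifferentiable (by simp) (α t))
          (hα.mdifferentiableAt ht)
        rwa [hz t ht, inner_zero_right] at h1) h₁ h₂
      simp only [hz t₁ h₁, hz t₂ h₂, InnerProductGeometry.angle_zero_left, hf0]
    · have hv' : velocity (E := E) α t₂ ≠ 0 := by rwa [← norm_ne_zero_iff, ← hn, norm_ne_zero_iff]
      have h1 := hα.eq_of_hasDerivAt_zero (fun t ht ↦ by
        have h2 := hα.hasDerivAt_exp_mul_norm_vPart h hf ht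
        rwa [hD α s hα t ht, mul_zero] at h2) h₁ h₂
      have h3 := (sq_eq_sq₀ (by positivity) (by positivity)).1 h1
      rw [← norm_mul_sin_angle_hPart hv, ← norm_mul_sin_angle_hPart hv', hn, mul_left_comm,
        mul_left_comm (Real.exp (f (α t₂)))] at h3
      exact mul_left_cancel₀ (norm_ne_zero_iff.2 hv') h3

/-- A geodesic starting in a vertical direction `w` has `‖V‖` maximal initially, so `‖V‖²` is
stationary there and the differential identity of `isClairautWith_exp_iff` leaves `df(w) = 0`. -/
lemma grad_mem_horizontal (h : IsRiemannianSubmersion E F pr) {f : M → ℝ}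
    (hD : ∀ (α : ℝ → M) (s : Set ℝ), IsGeodesicOn (E := E) α s → ∀ t ∈ s,
        (inner ℝ (grad (E := E) f (α t)) (velocity (E := E) α t) : ℝ)
            * ‖vPart F pr (α t) (velocity (E := E) α t)‖ ^ 2
          + (inner ℝ (covDerivAlong (E := E) α (fun t ↦ vPart F pr (α t) (velocity α t)) t)
            (vPart F pr (α t) (velocity (E := E) α t)) : ℝ) = 0) (x : M) :
    grad f x ∈ horizontal E F pr x := by
  rw [horizontal, Submodule.mem_orthogonal']
  intro w hw
  by_cases hw0 : w = 0
  · rw [hw0, inner_zero_right]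
  obtain ⟨α, s, hα, h0, rfl, hvel⟩ := exists_geodesic x w
  have hvel : velocity (E := E) α 0 = w := coordL_injective (mem_extChartAt_source _) hvel
  have hV : vPart F pr (α 0) (velocity (E := E) α 0) = velocity (E := E) α 0 := by
    rw [hvel]
    exact vPart_eq_self hw
  have hmax : IsLocalMax (fun t ↦ ‖vPart F pr (α t) (velocity (E := E) α t)‖ ^ 2) 0 := by
    filter_upwards [hα.isOpen.mem_nhds h0] with t ht
    have h1 := norm_sq_eq_vPart_add_hPart (F := F) (pr := pr) (α t) (velocity (E := E) α t)
    rw [hV, ← hα.norm_velocity_eq ht h0, h1]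
    exact le_add_of_nonneg_right (sq_nonneg _)
  have h2 := hmax.hasDerivAt_eq_zero (hα.hasDerivAt_norm_vPart_sq h h0)
  have h3 := hD α s hα 0 h0
  rw [(mul_eq_zero.1 h2).resolve_left two_ne_zero, add_zero, hV, hvel] at h3
  exact (mul_eq_zero.1 h3).resolve_right (pow_ne_zero 2 (norm_ne_zero_iff.2 hw0))

end Clairaut

/-! ### Smooth extensions of tangent vectors -/

section SmoothField

variable {E : Type*} [NormedAddCommGroup E] [NormedSpace ℝ E] [FiniteDimensional ℝ E]
  {M : Type*} [TopologicalSpace M] [ChartedSpace E M] [IsManifold 𝓘(ℝ, E) ∞ M]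

/-- Every tangent vector extends to a smooth vector field. -/
lemma exists_isSmoothField [T2Space M] (x : M) (w : TangentSpace 𝓘(ℝ, E) x) :
    ∃ Y : ∀ y : M, TangentSpace 𝓘(ℝ, E) y, IsSmoothField Y ∧ Y x = w := by
  have hx : x ∈ (extChartAt 𝓘(ℝ, E) x).source := mem_extChartAt_source x
  obtain ⟨ρ⟩ : Nonempty (SmoothBumpFunction 𝓘(ℝ, E) x) := inferInstance
  refine ⟨fun y ↦ ρ y • frameL x y (coordL x x w), ?_, ?_⟩
  · exact ContMDiffOn.smul_section_of_tsupport ρ.contMDiff.contMDiffOn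
      (isOpen_extChartAt_source x) ρ.tsupport_subset_extChartAt_source
      (contMDiffOn_frameL x (coordL x x w))
  · simp only [ρ.eq_one, one_smul, frameL_coordL hx]

variable [RiemannianBundle (fun x : M ↦ TangentSpace 𝓘(ℝ, E) x)]
  [IsContMDiffRiemannianBundle 𝓘(ℝ, E) ∞ E (fun x : M ↦ TangentSpace 𝓘(ℝ, E) x)]

lemma nabla_add_right {x : M} {Y : ∀ x : M, TangentSpace 𝓘(ℝ, E) x}
    (hY : DifferentiableAt ℝ (fieldRep x Y) (extChartAt 𝓘(ℝ, E) x x))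
    (v w : TangentSpace 𝓘(ℝ, E) x) : nabla Y x (v + w) = nabla Y x v + nabla Y x w := by
  have hx : x ∈ (extChartAt 𝓘(ℝ, E) x).source := mem_extChartAt_source x
  refine coordL_injective hx ?_
  rw [map_add, coordL_nabla hx hY, coordL_nabla hx hY, coordL_nabla hx hY, map_add, map_add,
    christoffel_add_left (mem_extChartAt_target x)]
  abel

end SmoothField

/-! ### The Clairaut formula -/

section Main

variable {E : Type*} [NormedAddCommGroup E] [NormedSpace ℝ E] [FiniteDimensional ℝ E]
  {M : Type*} [TopologicalSpace M] [ChartedSpace E M] [IsManifold 𝓘(ℝ, E) ∞ M]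
  [RiemannianBundle (fun x : M ↦ TangentSpace 𝓘(ℝ, E) x)]
  {F : Type*} [NormedAddCommGroup F] [NormedSpace ℝ F] [FiniteDimensional ℝ F]
  {N : Type*} [TopologicalSpace N] [ChartedSpace F N] [IsManifold 𝓘(ℝ, F) ∞ N]
  {pr : M → N}

lemma inner_hPart_left {x : M} (v : TangentSpace 𝓘(ℝ, E) x) {w : TangentSpace 𝓘(ℝ, E) x}
    (hw : w ∈ horizontal E F pr x) : (inner ℝ (hPart F pr x v) w : ℝ) = inner ℝ v w := by
  conv_rhs => rw [← vPart_add_hPart (F := F) (pr := pr) x v, inner_add_left,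
    inner_vertical_horizontal (vPart_mem x v) hw, zero_add]

variable [IsContMDiffRiemannianBundle 𝓘(ℝ, E) ∞ E (fun x : M ↦ TangentSpace 𝓘(ℝ, E) x)]
  [RiemannianBundle (fun y : N ↦ TangentSpace 𝓘(ℝ, F) y)]
  [IsContMDiffRiemannianBundle 𝓘(ℝ, F) ∞ F (fun y : N ↦ TangentSpace 𝓘(ℝ, F) y)]

/-- For a vertical field `W` along a curve with velocity `V + X`, the horizontal part of its
covariant derivative is `(T_V + A_X) W`. -/
lemma inner_covDerivAlong_vertical (h : IsRiemannianSubmersion E F pr) {α : ℝ → M} {t : ℝ}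
    (hα : MDifferentiableAt 𝓘(ℝ, ℝ) 𝓘(ℝ, E) α t) {W : ∀ t, TangentSpace 𝓘(ℝ, E) (α t)}
    (hW : DiffAlong α W t) (hWv : ∀ t, W t ∈ vertical E F pr (α t))
    {z : TangentSpace 𝓘(ℝ, E) (α t)} (hz : z ∈ horizontal E F pr (α t)) :
    (inner ℝ (covDerivAlong α W t) z : ℝ) =
      inner ℝ (oneillT F pr (α t) (vPart F pr (α t) (velocity α t)) (W t)
        + oneillA F pr (α t) (hPart F pr (α t) (velocity α t)) (W t)) z := by
  have hP := h.diffEndAt_vertical (α t)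
  have hY := differentiableAt_fieldRep_extend (E := E) (W t)
  have hYd : DifferentiableAt ℝ (fieldRep (α t) fun y ↦ vPart F pr y (FiberBundle.extend E (W t) y))
      (extChartAt 𝓘(ℝ, E) (α t) (α t)) := (hP.clm_apply hY).congr_of_eventuallyEq (by
    filter_upwards [target_mem_nhds (mem_extChartAt_source (α t))] with u hu
    exact fieldRep_end_apply hu _)
  have e1 : W = fun s ↦ (vertical E F pr (α s)).starProjection (W s) :=
    funext fun s ↦ (vPart_eq_self (hWv s)).symm
  have h1 := covDerivAlong_end hP hα hW hY (by simp)
  rw [← e1] at h1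
  have h2 : (inner ℝ (covDerivAlong α W t) z : ℝ) =
      inner ℝ (nabla (fun y ↦ vPart F pr y (FiberBundle.extend E (W t) y)) (α t)
        (velocity α t)) z := by
    rw [h1, inner_add_left, inner_sub_left,
      inner_vertical_horizontal (Submodule.starProjection_apply_mem _ _) hz,
      inner_vertical_horizontal (Submodule.starProjection_apply_mem _ _) hz, sub_zero, add_zero]
    rfl
  rw [h2, oneillT, oneillA, inner_add_left, inner_add_left, inner_add_left,
    inner_vertical_horizontal (vPart_mem _ _) hz, inner_vertical_horizontal (vPart_mem _ _) hz,
    inner_hPart_left _ hz, inner_hPart_left _ hz, zero_add, zero_add, ← inner_add_left,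
    vPart_eq_self (vPart_mem _ _), hPart_eq_self (hPart_mem _ _), ← nabla_add_right hYd,
    vPart_add_hPart]

variable {S : AlmostContactMetric E M}

/-- Along a geodesic of a Kenmotsu manifold, `∇_{α'} (φ α') = -η(α') φ α'`. -/
lemma IsGeodesicOn.covDerivAlong_φ_velocity [T2Space M] (hS : S.IsKenmotsu) {α : ℝ → M} {s : Set ℝ}
    (hα : IsGeodesicOn (E := E) α s) {t : ℝ} (ht : t ∈ s) :
    covDerivAlong α (fun u ↦ S.φ (α u) (velocity α u)) t =
      -(S.η (α t) (velocity α t) • S.φ (α t) (velocity α t)) := by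
  obtain ⟨Y, hY, hYt⟩ := exists_isSmoothField (α t) (velocity (E := E) α t)
  rw [covDerivAlong_end (S.diffEndAt_φ _) (hα.mdifferentiableAt ht) (hα.diffAlong ht)
    (hY.differentiableAt_fieldRep _) hYt, hS.nabla_φ Y hY, hα.covDeriv_velocity t ht, map_zero,
    add_zero, hYt, S.inner_φ_self, zero_smul, zero_sub]

/-- If `ξ` is horizontal, the right-hand side of the Clairaut formula is
`-g(∇_{α'} V, V) - η(X) ‖V‖²`: decompose `φ α' = φ V + ℬ X + 𝒞 X`, differentiate, and pair with the
horizontal vector `φ V`. -/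
lemma IsGeodesicOn.inner_covDerivAlong_C [T2Space M] (hS : S.IsKenmotsu)
    (hpr : S.IsAntiInvariant F pr) (hξ : S.ReebHorizontal F pr) {α : ℝ → M} {s : Set ℝ}
    (hα : IsGeodesicOn (E := E) α s) {t : ℝ} (ht : t ∈ s)
    {V X : ∀ t, TangentSpace 𝓘(ℝ, E) (α t)}
    (hV : ∀ t, V t = vPart F pr (α t) (velocity α t))
    (hX : ∀ t, X t = hPart F pr (α t) (velocity α t)) :
    (inner ℝ (hPart F pr (α t) (covDerivAlong α (fun u ↦ S.C F pr (α u) (X u)) t)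
        + (oneillT F pr (α t) (V t) (S.B F pr (α t) (X t))
          + oneillA F pr (α t) (X t) (S.B F pr (α t) (X t)))) (S.φ (α t) (V t)) : ℝ) =
      -inner ℝ (covDerivAlong α V t) (V t) - S.η (α t) (X t) * ‖V t‖ ^ 2 := by
  obtain rfl : V = fun t ↦ vPart F pr (α t) (velocity α t) := funext hV
  obtain rfl : X = fun t ↦ hPart F pr (α t) (velocity α t) := funext hX
  have h := hpr.isRiemannianSubmersion
  have hαt := hα.mdifferentiableAt ht
  set V : ∀ t, TangentSpace 𝓘(ℝ, E) (α t) := fun t ↦ vPart F pr (α t) (velocity α t) with hVdef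
  set X : ∀ t, TangentSpace 𝓘(ℝ, E) (α t) := fun t ↦ hPart F pr (α t) (velocity α t) with hXdef
  have hVv (u : ℝ) : V u ∈ vertical E F pr (α u) := vPart_mem _ _
  have hφV (u : ℝ) : S.φ (α u) (V u) ∈ horizontal E F pr (α u) := hpr.φ_mem _ _ (hVv u)
  have hηV (u : ℝ) : S.η (α u) (V u) = 0 := by
    rw [S.η_eq_inner]
    exact inner_vertical_horizontal (hVv u) (hξ _)
  have hvel (u : ℝ) : V u + X u = velocity α u := vPart_add_hPart _ _
  have dV : DiffAlong (E := E) α V t := hα.diffAlong_vPart h ht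
  have dX : DiffAlong (E := E) α X t := (hα.diffAlong ht).end_apply (h.diffEndAt_horizontal _) hαt
  have dφV := dV.end_apply (S.diffEndAt_φ _) hαt
  have dφX := dX.end_apply (S.diffEndAt_φ _) hαt
  have dB : DiffAlong (E := E) α (fun u ↦ S.B F pr (α u) (X u)) t :=
    dφX.end_apply (h.diffEndAt_vertical _) hαt
  have dC : DiffAlong (E := E) α (fun u ↦ S.C F pr (α u) (X u)) t :=
    dφX.end_apply (h.diffEndAt_horizontal _) hαt
  have hsplit : (fun u ↦ S.φ (α u) (velocity α u)) =
      fun u ↦ S.φ (α u) (V u) + S.B F pr (α u) (X u) + S.C F pr (α u) (X u) := by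
    funext u
    rw [add_assoc, ← hvel u, map_add]
    exact congrArg _ (vPart_add_hPart _ _).symm
  have h1 := hα.covDerivAlong_φ_velocity hS ht
  rw [hsplit, covDerivAlong_add hαt (dφV.add dB) dC, covDerivAlong_add hαt dφV dB] at h1
  have h2 := congrArg (fun w ↦ (inner ℝ w (S.φ (α t) (V t)) : ℝ)) h1
  simp only [inner_add_left, inner_neg_left, real_inner_smul_left] at h2
  -- `φ` is isometric on vertical vectors, so `φ V` and `V` have the same length along `α`
  have h3 : (inner ℝ (covDerivAlong α (fun u ↦ S.φ (α u) (V u)) t) (S.φ (α t) (V t)) : ℝ) =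
      inner ℝ (covDerivAlong α V t) (V t) := by
    have a1 := hasDerivAt_inner_along hαt dφV dφV
    have a2 := hasDerivAt_inner_along hαt dV dV
    simp only [S.inner_φ_φ, hηV, mul_zero, sub_zero] at a1
    have a3 := a1.unique a2
    rw [real_inner_comm (covDerivAlong α (fun u ↦ S.φ (α u) (V u)) t),
      real_inner_comm (covDerivAlong α V t)] at a3
    linarith
  have h4 : (inner ℝ (S.φ (α t) (velocity α t)) (S.φ (α t) (V t)) : ℝ) = ‖V t‖ ^ 2 := by
    rw [S.inner_φ_φ, hηV, mul_zero, sub_zero, ← hvel t, inner_add_left,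
      inner_horizontal_vertical (hPart_mem _ _) (hVv t), add_zero, real_inner_self_eq_norm_sq]
  have h5 : S.η (α t) (velocity α t) = S.η (α t) (X t) := by
    rw [← hvel t, map_add, hηV, zero_add]
  have h6 := inner_covDerivAlong_vertical h hαt dB (fun u ↦ vPart_mem _ _) (hφV t)
  rw [inner_add_left, inner_hPart_left _ (hφV t)]
  rw [h3, h4, h5] at h2
  linarith

end Main

end Clairaut

end

theorem mainTheorem4
    {E : Type*} [NormedAddCommGroup E] [NormedSpace ℝ E] [FiniteDimensional ℝ E]
    {M : Type*} [TopologicalSpace M] [T2Space M] [ChartedSpace E M] [IsManifold 𝓘(ℝ, E) ∞ M]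
    [RiemannianBundle (fun x : M ↦ TangentSpace 𝓘(ℝ, E) x)]
    [IsContMDiffRiemannianBundle 𝓘(ℝ, E) ∞ E (fun x : M ↦ TangentSpace 𝓘(ℝ, E) x)]
    {F : Type*} [NormedAddCommGroup F] [NormedSpace ℝ F] [FiniteDimensional ℝ F]
    {N : Type*} [TopologicalSpace N] [T2Space N] [ChartedSpace F N] [IsManifold 𝓘(ℝ, F) ∞ N]
    [RiemannianBundle (fun y : N ↦ TangentSpace 𝓘(ℝ, F) y)]
    [IsContMDiffRiemannianBundle 𝓘(ℝ, F) ∞ F (fun y : N ↦ TangentSpace 𝓘(ℝ, F) y)]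
    (S : Clairaut.AlmostContactMetric E M) (hS : S.IsKenmotsu)
    (pr : M → N) (hpr : S.IsAntiInvariant F pr)
    (hξ : S.ReebVertical F pr ∨ S.ReebHorizontal F pr)
    (f : M → ℝ) (hf : ContMDiff 𝓘(ℝ, E) 𝓘(ℝ, ℝ) ∞ f) :
    Clairaut.IsClairautWith E F pr (fun x ↦ Real.exp (f x)) ↔
      (∀ x, Clairaut.grad f x ∈ Clairaut.horizontal E F pr x) ∧
      ∀ (α : ℝ → M) (s : Set ℝ), Clairaut.IsGeodesicOn (E := E) α s →
        ∀ V X : (∀ t, TangentSpace 𝓘(ℝ, E) (α t)),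
          (∀ t, V t = Clairaut.vPart F pr (α t) (Clairaut.velocity α t)) →
          (∀ t, X t = Clairaut.hPart F pr (α t) (Clairaut.velocity α t)) →
          ∀ t ∈ s,
            ((inner ℝ (Clairaut.grad f (α t)) (X t) : ℝ) - S.η (α t) (X t)) * ‖V t‖ ^ 2 =
              inner ℝ
                (Clairaut.hPart F pr (α t)
                    (Clairaut.covDerivAlong α (fun u ↦ S.C F pr (α u) (X u)) t)
                  + (Clairaut.oneillT F pr (α t) (V t) (S.B F pr (α t) (X t))
                    + Clairaut.oneillA F pr (α t) (X t) (S.B F pr (α t) (X t))))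
                (S.φ (α t) (V t)) := by
  have h := hpr.isRiemannianSubmersion
  rw [Clairaut.isClairautWith_exp_iff h hf]
  have hsplit (α : ℝ → M) (t : ℝ) (hg : Clairaut.grad f (α t) ∈ Clairaut.horizontal E F pr (α t)) :
      (inner ℝ (Clairaut.grad (E := E) f (α t)) (Clairaut.velocity (E := E) α t) : ℝ) =
        inner ℝ (Clairaut.grad (E := E) f (α t))
          (Clairaut.hPart F pr (α t) (Clairaut.velocity (E := E) α t)) := by
    rw [real_inner_comm, ← Clairaut.inner_hPart_left _ hg, real_inner_comm]
  rcases hξ with hξ | hξ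
  · -- a vertical Reeb field leaves no horizontal vectors, and both sides reduce to `∇f = 0`
    have hz (x : M) (v : TangentSpace 𝓘(ℝ, E) x) (hv : v ∈ Clairaut.horizontal E F pr x) :
        v = 0 := hξ.eq_zero_of_mem_horizontal hS h hv
    constructor
    · refine fun hD ↦ ⟨Clairaut.grad_mem_horizontal h hD, fun α s hα V X hV hX t ht ↦ ?_⟩
      rw [hX t, hz _ _ (Clairaut.hPart_mem _ _),
        hz _ _ (hpr.φ_mem _ (V t) (hV t ▸ Clairaut.vPart_mem _ _)), inner_zero_right,
        inner_zero_right, map_zero, sub_zero, zero_mul]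
    · rintro ⟨hg, -⟩ α s hα t ht
      have hV (u : ℝ) : Clairaut.vPart F pr (α u) (Clairaut.velocity (E := E) α u) =
          Clairaut.velocity α u := by
        have h1 := Clairaut.vPart_add_hPart (F := F) (pr := pr) (α u)
          (Clairaut.velocity (E := E) α u)
        rwa [hz _ _ (Clairaut.hPart_mem _ _), add_zero] at h1
      simp only [hV]
      rw [hα.covDeriv_velocity t ht, inner_zero_left, add_zero, hz _ _ (hg _),
        inner_zero_left, zero_mul]
  · constructor
    · intro hD
      have hg := Clairaut.grad_mem_horizontal h hD
      refine ⟨hg, fun α s hα V X hV hX t ht ↦ ?_⟩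
      rw [hα.inner_covDerivAlong_C hS hpr hξ ht hV hX]
      have h1 := hD α s hα t ht
      obtain rfl : V = fun t ↦ Clairaut.vPart F pr (α t) (Clairaut.velocity α t) := funext hV
      rw [hsplit α t (hg _), ← hX t] at h1
      linarith
    · rintro ⟨hg, hF⟩ α s hα t ht
      have h1 := hF α s hα _ _ (fun _ ↦ rfl) (fun _ ↦ rfl) t ht
      rw [hα.inner_covDerivAlong_C hS hpr hξ ht (fun _ ↦ rfl) (fun _ ↦ rfl)] at h1
      rw [hsplit α t (hg _)]
      linarith
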